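/- Let $n\ge 0$. Graphs are simple graphs on the labeled nodes $1,\dots,n+1$; $\mathcal C_{n+1}$ is the set of connected ones. A plane tree is an unlabeled rooted tree in which the subtrees at each node are linearly ordered from left to right; the degree of a node is its number of successors, and the degree sequence $(d_1,\dots,d_{n+1})$ of a plane tree on $n+1$ nodes lists the degrees in the order of the depth-first traversal (root first, subtrees from left to right). *The map $\Psi$.* For $G\in\mathcal C_{n+1}$ perform the neighbor-first search: node $n+1$ is visited first and is the first active node. At each step, visit the previously unvisited neighbors of the active node in decreasing order of their labels; these become its successors in the search tree. The next active node is the last visited node that has not yet been active. $\Psi(G)$ is the plane tree obtained from the search tree by ordering the successors of each node by increasing labels from left to right and then erasing the labels. *The sets $D_T$.* Let $T$ be a plane tree on $n+1$ nodes. Run the same search on $T$ (visit the successors of the active node from right to left) and attach to each node a coordinate $x_i/2^j$, where $i$ is the position of the node in the order of visits (the root has position $0$) and $j$ is determined as follows: the root has $j=0$, and if a node has exponent $j$, then its successors, from right to left, have exponents $j,j+1,\dots,j+k-1$. Let $D_T\subset\mathbb R^n$ be the set of all $(x_1,\dots,x_n)$ such that, for each node of $T$ with $k\ge1$ successors, whose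 coordinates from right to left are $x_i/2^j,\,x_{i+1}/2^{j+1},\dots,x_{i+k-1}/2^{j+k-1}$, $$1\le \frac{x_{i+k-1}}{2^{j+k-1}}\le\dots\le\frac{x_{i+1}}{2^{j+1}}\le\frac{x_i}{2^j}\le 2 .$$ *The Cayley polytope.* $C_n\subset\mathbb R^n$ is defined by $1\le x_1\le 2$ and $1\le x_i\le 2x_{i-1}$ for $i=2,\dots,n$. **Theorem.** For every plane tree $T$ on $n+1$ nodes, $D_T$ is a bounded polytope (the convex hull of a finite set), and $$n!\,\mathrm{vol}\,D_T=\bigl|\{G\in\mathcal C_{n+1}:\Psi(G)=T\}\bigr| = 2^{\binom{n+1}2-\sum_{i=1}^{n+1} i d_i}\binom{n}{d_1,\dots,d_{n+1}},$$ where $(d_1,\dots,d_{n+1})$ is the degree sequence of $T$. There are exactly $\frac1{n+1}\binom{2n}{n}$ plane trees on $n+1$ nodes, and the polytopes $D_T$, for all these $T$, form a polytopal subdivision of $C_n$: they are $n$-dimensional, their union is $C_n$, the interiors of $D_T$ and $D_{T'}$ are disjoint for $T\ne T'$, and any two of them meet in a common (possibly empty) face. In particular, $n!\,\mathrm{vol}\,C_n=|\mathcal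 C_{n+1}|$. -/

import Mathlib

open scoped Nat ENNReal

/-- An (unlabeled) plane tree: a root together with the list of the subtrees at its successors,
linearly ordered from left to right. -/
inductive PlaneTree : Type
  | node : List PlaneTree → PlaneTree

namespace PlaneTree

mutual
  /-- The number of nodes of a plane tree. -/
  def numNodes : PlaneTree → ℕ
    | node ts => 1 + numNodesForest ts
  /-- The total number of nodes of a list of plane trees. -/
  def numNodesForest : List PlaneTree → ℕ
    | [] => 0
    | t :: ts => numNodes t + numNodesForest ts
end

mutual
  /-- The degree sequence of a plane tree: the numbers of successors of its nodes, listed in the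
  order of the depth-first traversal (root first, then the subtrees from left to right). -/
  def degSeq : PlaneTree → List ℕ
    | node ts => ts.length :: degSeqForest ts
  /-- The concatenation of the degree sequences of a list of plane trees. -/
  def degSeqForest : List PlaneTree → List ℕ
    | [] => []
    | t :: ts => degSeq t ++ degSeqForest ts
end

/-- The term `d_i` (for `i = 1, 2, …`) of the degree sequence of `T`, and `0` beyond its end. -/
def deg (T : PlaneTree) (i : ℕ) : ℕ := T.degSeq.getD (i - 1) 0

mutual
  /-- Each node of a plane tree carries a coordinate `x_i / 2 ^ j`, where `i` is its position in
  the neighbor-first search and the root carries `x_0 / 2 ^ 0`.  If a node has exponent `j` and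
  `k` successors, then these carry, from right to left, the coordinates
  `x_i / 2 ^ j, x_{i+1} / 2 ^ (j+1), …, x_{i+k-1} / 2 ^ (j+k-1)`, where `i` is the first position
  that is still free when the node becomes active.  After that the subtrees at the successors are
  searched completely, one after the other, from left to right.

  `blocks T i j` lists the triples `(i', j', k')` that describe in this way the coordinates of the
  successors of each node of `T` (in depth-first order), for a tree `T` whose root has exponent `j`
  and becomes active when `i` is the first free position. -/
  def blocks : PlaneTree → ℕ → ℕ → List (ℕ × ℕ × ℕ)
    | node ts, i, j => (i, j, ts.length) :: blocksForest ts (i + ts.length) j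
  /-- The same for a list of trees whose roots are the successors, from left to right, of one node
  with exponent `j` (the positions of these roots have been given out already): a successor with
  `r` siblings to its right has exponent `j + r`, and searching the subtree at it uses up one
  position for each of its nodes except the root. -/
  def blocksForest : List PlaneTree → ℕ → ℕ → List (ℕ × ℕ × ℕ)
    | [], _, _ => []
    | t :: ts, i, j =>
        blocks t i (j + ts.length) ++ blocksForest ts (i + (numNodes t - 1)) j
end

end PlaneTree

/-- The coordinate `x_i`, `1 ≤ i ≤ n`, of the point `x = (x_1, …, x_n)`; by convention `x_0 = 1`.
(Indices larger than `n` never matter.) -/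
def coord {n : ℕ} (x : Fin n → ℝ) (i : ℕ) : ℝ :=
  if h : 1 ≤ i ∧ i ≤ n then x ⟨i - 1, by omega⟩ else 1

/-- The Cayley polytope: `1 ≤ x_1 ≤ 2` and `1 ≤ x_i ≤ 2 x_{i-1}` for `i = 2, …, n`. -/
def cayleyPolytope (n : ℕ) : Set (Fin n → ℝ) :=
  {x | ∀ i, 1 ≤ i → i ≤ n → 1 ≤ coord x i ∧ coord x i ≤ 2 * coord x (i - 1)}

/-- The set `D_T ⊆ ℝⁿ` of a plane tree `T` on `n + 1` nodes: for each node with `k ≥ 1` successors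
with coordinates `x_i / 2 ^ j, …, x_{i+k-1} / 2 ^ (j+k-1)`, the inequalities
`1 ≤ x_{i+k-1} / 2 ^ (j+k-1) ≤ … ≤ x_{i+1} / 2 ^ (j+1) ≤ x_i / 2 ^ j ≤ 2`. -/
def treePolytope (n : ℕ) (T : PlaneTree) : Set (Fin n → ℝ) :=
  {x | ∀ i j k : ℕ, (i, j, k) ∈ T.blocks 1 0 → 1 ≤ k →
    1 ≤ coord x (i + k - 1) / 2 ^ (j + k - 1) ∧
    (∀ m, m + 1 < k →
      coord x (i + m + 1) / 2 ^ (j + m + 1) ≤ coord x (i + m) / 2 ^ (j + m)) ∧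
    coord x i / 2 ^ j ≤ 2}

/-- A state of the neighbor-first search: the visited nodes, the visited nodes that have not been
active yet (the last visited one first), and the successors in the search tree of the nodes that
have been active. -/
structure NFSState (n : ℕ) where
  visited : Finset (Fin (n + 1))
  waiting : List (Fin (n + 1))
  children : Fin (n + 1) → Finset (Fin (n + 1))

namespace NFSState

/-- At the start only the node with the maximal label is visited, and it will be active first. -/
def init (n : ℕ) : NFSState n where
  visited := {Fin.last n}
  waiting := [Fin.last n]
  children := fun _ => ∅

open Classical in
/-- One step of the search: the last visited node `v` that has not been active becomes active, and
its unvisited neighbors are visited in decreasing order of their labels (so that the one with the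
smallest label is now the last visited node); they become the successors of `v`. -/
noncomputable def step {n : ℕ} (G : SimpleGraph (Fin (n + 1))) (s : NFSState n) : NFSState n :=
  match s.waiting with
  | [] => s
  | v :: rest =>
    let C : Finset (Fin (n + 1)) := Finset.univ.filter fun w => G.Adj v w ∧ w ∉ s.visited
    { visited := s.visited ∪ C
      waiting := C.sort (· ≤ ·) ++ rest
      children := Function.update s.children v C }

end NFSState

/-- The search tree of the neighbor-first search on a connected graph `G` on `n + 1` labeled nodes
(every node is active in exactly one of the `n + 1` steps): the tree is rooted at the node
`Fin.last n`, and is given by the set of successors of each node. -/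
noncomputable def nfsTree {n : ℕ} (G : SimpleGraph (Fin (n + 1))) :
    Fin (n + 1) → Finset (Fin (n + 1)) :=
  ((NFSState.step G)^[n + 1] (NFSState.init n)).children

/-- Erasing labels: the plane tree of the descendants of `v`, down to the given depth, where the
successors of each node are ordered from left to right by increasing labels. -/
def eraseLabels {n : ℕ} (children : Fin (n + 1) → Finset (Fin (n + 1))) :
    ℕ → Fin (n + 1) → PlaneTree
  | 0, _ => .node []
  | depth + 1, v => .node (((children v).sort (· ≤ ·)).map (eraseLabels children depth))

/-- The plane tree `Ψ(G)` of a connected graph `G` on `n + 1` labeled nodes: the search tree of `G`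
with the labels erased.  (A tree on `n + 1` nodes has depth at most `n`.) -/
noncomputable def Psi {n : ℕ} (G : SimpleGraph (Fin (n + 1))) : PlaneTree :=
  eraseLabels (nfsTree G) n (Fin.last n)

/-- A polytope (bounded, by this definition): the convex hull of a finite set. -/
def IsPolytope {n : ℕ} (P : Set (Fin n → ℝ)) : Prop :=
  ∃ V : Set (Fin n → ℝ), V.Finite ∧ P = convexHull ℝ V

/-- The sets `D t` are the cells of maximal dimension of a polytopal subdivision of `P ⊆ ℝⁿ`: they
are finitely many `n`-dimensional polytopes with union `P`, their interiors are pairwise disjoint,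
and any two of them meet in a common (possibly empty) face. -/
structure IsPolytopalSubdivision {n : ℕ} {ι : Type*} (P : Set (Fin n → ℝ))
    (D : ι → Set (Fin n → ℝ)) : Prop where
  finite : Finite ι
  isPolytope : ∀ t, IsPolytope (D t)
  interior_nonempty : ∀ t, (interior (D t)).Nonempty
  iUnion_eq : ⋃ t, D t = P
  interior_disjoint : ∀ s t, s ≠ t → Disjoint (interior (D s)) (interior (D t))
  inter_face : ∀ s t, IsExposed ℝ (D s) (D s ∩ D t) ∧ IsExposed ℝ (D t) (D s ∩ D t)

namespace PlaneTree

theorem numNodesForest_append (ts us : List PlaneTree) :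
    numNodesForest (ts ++ us) = numNodesForest ts + numNodesForest us := by
  induction ts with
  | nil => simp [numNodesForest]
  | cons t ts ih => simp [numNodesForest, ih, add_assoc]

theorem degSeqForest_append (ts us : List PlaneTree) :
    degSeqForest (ts ++ us) = degSeqForest ts ++ degSeqForest us := by
  induction ts with
  | nil => simp [degSeqForest]
  | cons t ts ih => simp [degSeqForest, ih]

theorem numNodes_pos (t : PlaneTree) : 1 ≤ numNodes t := by
  cases t; simp [numNodes]

theorem length_le_numNodesForest (ts : List PlaneTree) : ts.length ≤ numNodesForest ts := by
  induction ts with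
  | nil => simp
  | cons t ts ih => have := numNodes_pos t; simp [numNodesForest]; omega

theorem degSeqForest_node_cons (ts rest : List PlaneTree) :
    degSeqForest (node ts :: rest) = ts.length :: degSeqForest (ts ++ rest) := by
  simp [degSeqForest, degSeq, degSeqForest_append]

theorem numNodesForest_node_cons (ts rest : List PlaneTree) :
    numNodesForest (node ts :: rest) = 1 + numNodesForest (ts ++ rest) := by
  simp [numNodesForest, numNodes, numNodesForest_append, add_assoc]

/-- Induction over forests that removes the root of the first tree. -/
theorem forest_induction {P : List PlaneTree → Prop} (nil : P [])
    (node_cons : ∀ ts rest, P (ts ++ rest) → P (node ts :: rest)) (ts : List PlaneTree) : P ts := by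
  induction h : numNodesForest ts generalizing ts with
  | zero =>
    cases ts with
    | nil => exact nil
    | cons t ts => have := numNodes_pos t; simp [numNodesForest] at h; omega
  | succ N ih =>
    rcases ts with _ | ⟨⟨us⟩, ts⟩
    · exact nil
    · refine node_cons _ _ (ih _ ?_)
      rw [numNodesForest_node_cons] at h
      omega

theorem length_degSeqForest (ts : List PlaneTree) :
    (degSeqForest ts).length = numNodesForest ts := by
  induction ts using forest_induction with
  | nil => simp [degSeqForest, numNodesForest]
  | node_cons ts rest ih =>
    rw [degSeqForest_node_cons, numNodesForest_node_cons, List.length_cons, ih, add_comm]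

theorem sum_degSeqForest (ts : List PlaneTree) :
    (degSeqForest ts).sum + ts.length = numNodesForest ts := by
  induction ts using forest_induction with
  | nil => simp [degSeqForest, numNodesForest]
  | node_cons ts rest ih =>
    rw [degSeqForest_node_cons, numNodesForest_node_cons, List.sum_cons, ← ih]
    simp; omega

theorem degSeqForest_singleton (T : PlaneTree) : degSeqForest [T] = degSeq T := by
  simp [degSeqForest]

theorem numNodesForest_singleton (T : PlaneTree) : numNodesForest [T] = numNodes T := by
  simp [numNodesForest]

/-- The blocks of a forest, computed from its degree sequence: here `h` is the number of visited
nodes that have not been active yet. -/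
def degBlocks : List ℕ → ℕ → ℕ → List (ℕ × ℕ × ℕ)
  | [], _, _ => []
  | k :: ds, i, h => (i, h - 1, k) :: degBlocks ds (i + k) (h - 1 + k)

theorem blocksForest_append (ts us : List PlaneTree) (i j : ℕ) :
    blocksForest (ts ++ us) i j = blocksForest ts i (j + us.length) ++
      blocksForest us (i + (numNodesForest ts - ts.length)) j := by
  induction ts generalizing i with
  | nil => simp [blocksForest, numNodesForest]
  | cons t ts ih =>
    have h1 := numNodes_pos t
    have h2 := length_le_numNodesForest ts
    simp only [List.cons_append, blocksForest, ih, List.append_assoc, numNodesForest,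
      List.length_cons, List.length_append]
    rw [show j + (ts.length + us.length) = j + us.length + ts.length by omega,
      show i + (t.numNodes - 1) + (numNodesForest ts - ts.length) =
        i + (t.numNodes + numNodesForest ts - (ts.length + 1)) by omega]

theorem blocksForest_eq_degBlocks (ts : List PlaneTree) (i j : ℕ) :
    blocksForest ts i j = degBlocks (degSeqForest ts) i (j + ts.length) := by
  induction ts using forest_induction generalizing i j with
  | nil => simp [degSeqForest, degBlocks, blocksForest]
  | node_cons ts rest ih =>
    rw [degSeqForest_node_cons, degBlocks]
    simp only [blocksForest, blocks, List.length_cons, numNodes, List.cons_append]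
    congr 1
    have h2 := length_le_numNodesForest ts
    have := ih (i + ts.length) j
    rw [blocksForest_append] at this
    rw [show j + (rest.length + 1) - 1 + ts.length = j + (ts ++ rest).length by simp; omega, ← this]
    congr 2
    omega

theorem blocks_eq_degBlocks (T : PlaneTree) (i j : ℕ) :
    T.blocks i j = degBlocks T.degSeq i (j + 1) := by
  have := blocksForest_eq_degBlocks [T] i j
  simpa [blocksForest, degSeqForest] using this

/-- The exponents of the coordinates in the order of the visits, computed from the degree sequence:
here `h` is the number of visited nodes that have not been active yet. -/
def exponents : List ℕ → ℕ → List ℕ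
  | [], _ => []
  | k :: ds, h => List.range' (h - 1) k ++ exponents ds (h - 1 + k)

theorem length_exponents (ds : List ℕ) (h : ℕ) : (exponents ds h).length = ds.sum := by
  induction ds generalizing h with
  | nil => simp [exponents]
  | cons k ds ih => simp [exponents, ih]

/-- The head of the list `L`, if there is one, is smaller than `b`. -/
def HeadLT (L : List ℕ) (b : ℕ) : Prop := ∀ a ∈ L.head?, a < b

theorem HeadLT.mono {L : List ℕ} {b c : ℕ} (h : HeadLT L b) (hbc : b ≤ c) : HeadLT L c :=
  fun a ha => (h a ha).trans_le hbc

theorem headLT_range'_append {a k c : ℕ} {L : List ℕ} (h : HeadLT L (a + k)) (hc : a < c)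
    (hk : k = 0 → a + k ≤ c) : HeadLT (List.range' a k ++ L) c := by
  cases k with
  | zero => simpa using h.mono (hk rfl)
  | succ k => intro b hb; simp [List.range'_succ] at hb; omega

theorem headLT_exponents (ts : List PlaneTree) :
    HeadLT (exponents (degSeqForest ts) ts.length) ts.length := by
  induction ts using forest_induction with
  | nil => intro a; simp [degSeqForest, exponents]
  | node_cons ts rest ih =>
    rw [degSeqForest_node_cons, exponents]
    simp only [List.length_cons, Nat.add_sub_cancel]
    have : HeadLT (exponents (degSeqForest (ts ++ rest)) (rest.length + ts.length))
        (rest.length + ts.length) := by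
      simpa [add_comm] using ih
    exact headLT_range'_append this (by omega) (by omega)

/-- Lists in which no term exceeds its predecessor by more than one. -/
def SlowGrowth (L : List ℕ) : Prop := L.IsChain fun a b => b ≤ a + 1

theorem slowGrowth_range'_append {a k : ℕ} {L : List ℕ} (h : HeadLT L (a + k))
    (hL : SlowGrowth L) : SlowGrowth (List.range' a k ++ L) := by
  induction k generalizing a with
  | zero => simpa using hL
  | succ k ih =>
    rw [List.range'_succ, List.cons_append]
    have h' : HeadLT L (a + 1 + k) := by convert h using 1; omega
    refine List.isChain_cons.2 ⟨fun y hy => ?_, ih h'⟩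
    have := headLT_range'_append (c := a + 2) h' (by omega) (by omega) y hy
    omega

theorem slowGrowth_exponents (ts : List PlaneTree) :
    SlowGrowth (exponents (degSeqForest ts) ts.length) := by
  induction ts using forest_induction with
  | nil => simp [degSeqForest, exponents, SlowGrowth]
  | node_cons ts rest ih =>
    rw [degSeqForest_node_cons, exponents]
    simp only [List.length_cons, Nat.add_sub_cancel]
    have h1 := headLT_exponents (ts ++ rest)
    simp only [List.length_append, add_comm ts.length] at h1 ih
    exact slowGrowth_range'_append h1 ih

theorem exists_range'_append (L : List ℕ) (hL : SlowGrowth L) (a : ℕ) (ha : HeadLT L (a + 1)) :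
    ∃ k L', L = List.range' a k ++ L' ∧ HeadLT L' (a + k) ∧ SlowGrowth L' := by
  induction L generalizing a with
  | nil => exact ⟨0, [], by simp, by intro a; simp, hL⟩
  | cons b L ih =>
    rcases (show b < a ∨ b = a by have := ha b (by simp); omega) with h | rfl
    · exact ⟨0, b :: L, by simp, by intro c; simp; omega, hL⟩
    · obtain ⟨h1, h2⟩ := List.isChain_cons.1 hL
      obtain ⟨k, L', rfl, h3, h4⟩ := ih h2 (b + 1) fun y hy => by have := h1 y hy; omega
      exact ⟨k + 1, L', by simp [List.range'_succ], by convert h3 using 1; omega, h4⟩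

theorem exists_forest_of_slowGrowth (N : ℕ) : ∀ (L : List ℕ) (h : ℕ), L.length + h = N →
    SlowGrowth L → HeadLT L h →
    ∃ ts : List PlaneTree, ts.length = h ∧ exponents (degSeqForest ts) h = L := by
  induction N with
  | zero =>
    intro L h hN _ _
    have : L = [] := List.length_eq_zero_iff.1 (by omega)
    exact ⟨[], by simp; omega, by simp [degSeqForest, exponents, this]⟩
  | succ N ih =>
    intro L h hN hL hh
    rcases h with _ | h
    · cases L with
      | nil => exact ⟨[], rfl, by simp [degSeqForest, exponents]⟩
      | cons a L => exact absurd (hh a (by simp)) (by simp)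
    obtain ⟨k, L', rfl, h3, h4⟩ := exists_range'_append L hL h hh
    obtain ⟨us, hus, he⟩ := ih L' (h + k) (by simp at hN; omega) h4 h3
    refine ⟨node (us.take k) :: us.drop k, by simp; omega, ?_⟩
    rw [degSeqForest_node_cons, List.take_append_drop, exponents]
    have : (us.take k).length = k := by simp; omega
    simp [this, he]

theorem range'_append_inj {a k l : ℕ} {L M : List ℕ} (hL : HeadLT L (a + k))
    (hM : HeadLT M (a + l)) (h : List.range' a k ++ L = List.range' a l ++ M) :
    k = l ∧ L = M := by
  induction k generalizing a l with
  | zero =>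
    cases l with
    | zero => simpa using h
    | succ l =>
      simp [List.range'_succ] at h
      have := hL a (by simp [h])
      omega
  | succ k ih =>
    cases l with
    | zero =>
      simp [List.range'_succ] at h
      have := hM a (by simp [← h])
      omega
    | succ l =>
      simp only [List.range'_succ, List.cons_append, List.cons.injEq, true_and] at h
      have := ih (a := a + 1) (l := l) (by convert hL using 1; omega)
        (by convert hM using 1; omega) h
      exact ⟨by omega, this.2⟩

theorem forest_eq_of_exponents_eq (ts : List PlaneTree) : ∀ us : List PlaneTree,
    us.length = ts.length →
    exponents (degSeqForest us) ts.length = exponents (degSeqForest ts) ts.length → us = ts := by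
  induction ts using forest_induction with
  | nil => intro us h _; simpa using h
  | node_cons ts rest ih =>
    intro us hlen h
    rcases us with _ | ⟨⟨us⟩, rest'⟩
    · simp at hlen
    simp only [List.length_cons, add_left_inj] at hlen
    rw [degSeqForest_node_cons, degSeqForest_node_cons, exponents, exponents] at h
    simp only [List.length_cons, Nat.add_sub_cancel] at h
    have h1 := headLT_exponents (ts ++ rest)
    have h2 := headLT_exponents (us ++ rest')
    simp only [List.length_append, add_comm _ rest.length, hlen] at h1 h2
    obtain ⟨h3, h4⟩ := range'_append_inj h2 h1 h
    have h5 := ih (us ++ rest') (by simp; omega)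
      (by rw [h3] at h4; simpa [add_comm] using h4)
    obtain ⟨rfl, rfl⟩ := List.append_inj h5 h3
    rfl

theorem exponents_injective {S T : PlaneTree}
    (h : exponents S.degSeq 1 = exponents T.degSeq 1) : S = T := by
  have := forest_eq_of_exponents_eq [T] [S] rfl (by simpa [degSeqForest] using h)
  simpa using this

theorem degSeq_injective : Function.Injective degSeq := fun _ _ h =>
  exponents_injective (by rw [h])

theorem exists_tree_of_slowGrowth (L : List ℕ) (hL : SlowGrowth L) (h : HeadLT L 1) :
    ∃ T : PlaneTree, T.numNodes = L.length + 1 ∧ exponents T.degSeq 1 = L := by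
  obtain ⟨ts, h1, h2⟩ := exists_forest_of_slowGrowth _ L 1 rfl hL h
  obtain ⟨T, rfl⟩ := List.length_eq_one_iff.1 h1
  rw [degSeqForest_singleton] at h2
  refine ⟨T, ?_, h2⟩
  have := sum_degSeqForest [T]
  rw [degSeqForest_singleton, numNodesForest_singleton] at this
  rw [← this, ← h2, length_exponents]
  rfl

theorem length_exponents_degSeq (T : PlaneTree) :
    (exponents T.degSeq 1).length + 1 = T.numNodes := by
  have := sum_degSeqForest [T]
  rw [degSeqForest_singleton, numNodesForest_singleton] at this
  rw [← this, length_exponents]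
  rfl

/-- The forest corresponding to a binary tree: the left subtree encodes the subtrees at the root of
the first tree, the right subtree the remaining trees. -/
def forestOfBinary : BinaryTree Unit → List PlaneTree
  | .nil => []
  | .node _ l r => node (forestOfBinary l) :: forestOfBinary r

theorem numNodesForest_forestOfBinary (b : BinaryTree Unit) :
    numNodesForest (forestOfBinary b) = b.numNodes := by
  induction b with
  | nil => simp [forestOfBinary, numNodesForest]
  | node _ l r hl hr =>
    simp [forestOfBinary, numNodesForest, numNodes, hl, hr]; omega

theorem forestOfBinary_injective : Function.Injective forestOfBinary := by
  intro b
  induction b with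
  | nil => intro c h; cases c <;> simp_all [forestOfBinary]
  | node _ l r hl hr =>
    intro c h
    cases c with
    | nil => simp [forestOfBinary] at h
    | node _ l' r' =>
      simp only [forestOfBinary, List.cons.injEq, node.injEq] at h
      rw [hl h.1, hr h.2]

theorem forestOfBinary_surjective (N : ℕ) : ∀ ts : List PlaneTree, numNodesForest ts = N →
    ∃ b, forestOfBinary b = ts := by
  induction N using Nat.strong_induction_on with
  | _ N ih =>
    intro ts h
    rcases ts with _ | ⟨⟨us⟩, ts⟩
    · exact ⟨.nil, rfl⟩
    · simp only [numNodesForest, numNodes] at h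
      obtain ⟨l, hl⟩ := ih (numNodesForest us) (by omega) us rfl
      obtain ⟨r, hr⟩ := ih (numNodesForest ts) (by omega) ts rfl
      exact ⟨.node () l r, by simp [forestOfBinary, hl, hr]⟩

/-- Plane trees with `n + 1` nodes correspond to binary trees with `n` internal nodes. -/
noncomputable def equivBinary (n : ℕ) :
    {b : BinaryTree Unit // b ∈ BinaryTree.treesOfNumNodesEq n} ≃
      {T : PlaneTree // T.numNodes = n + 1} :=
  Equiv.ofBijective
    (fun b => ⟨node (forestOfBinary b.1), by
      have := BinaryTree.mem_treesOfNumNodesEq.1 b.2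
      simp [numNodes, numNodesForest_forestOfBinary, this, add_comm]⟩)
    ⟨fun b c h => Subtype.ext (forestOfBinary_injective (by simpa using h)), by
      rintro ⟨⟨ts⟩, h⟩
      simp only [numNodes] at h
      obtain ⟨b, rfl⟩ := forestOfBinary_surjective _ ts rfl
      rw [numNodesForest_forestOfBinary] at h
      exact ⟨⟨b, BinaryTree.mem_treesOfNumNodesEq.2 (by omega)⟩, rfl⟩⟩

instance finite_numNodes (n : ℕ) : Finite {T : PlaneTree // T.numNodes = n + 1} :=
  Finite.of_equiv _ (equivBinary n)

theorem card_numNodes (n : ℕ) : Nat.card {T : PlaneTree // T.numNodes = n + 1} = catalan n := by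
  rw [← Nat.card_congr (equivBinary n), Nat.card_eq_fintype_card, Fintype.card_coe,
    BinaryTree.treesOfNumNodesEq_card_eq_catalan]

/-- The sum `1 * d_1 + 2 * d_2 + ⋯` of a list `d_1, d_2, …`. -/
def weightedSum : List ℕ → ℕ
  | [] => 0
  | k :: ds => k + (weightedSum ds + ds.sum)

theorem sum_exponents_add_weightedSum (ts : List PlaneTree) (N : ℕ)
    (hN : (degSeqForest ts).sum = N) :
    (exponents (degSeqForest ts) ts.length).sum + weightedSum (degSeqForest ts) + N =
      N * ts.length + (N + 1).choose 2 := by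
  induction ts using forest_induction generalizing N with
  | nil => simp [degSeqForest] at hN; simp [degSeqForest, exponents, weightedSum, ← hN]
  | node_cons ts rest ih =>
    rw [degSeqForest_node_cons] at hN ⊢
    obtain ⟨M, hM⟩ : ∃ M, (degSeqForest (ts ++ rest)).sum = M := ⟨_, rfl⟩
    have := ih M hM
    simp only [List.sum_cons, hM] at hN
    subst hN
    simp only [exponents, weightedSum, List.length_cons, Nat.add_sub_cancel, List.sum_append,
      List.length_append, hM] at this ⊢
    rw [add_comm rest.length]
    generalize (exponents (degSeqForest (ts ++ rest)) (ts.length + rest.length)).sum = A at *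
    generalize weightedSum (degSeqForest (ts ++ rest)) = B at *
    generalize ts.length = k at *
    generalize rest.length = r at *
    have key : ∀ k r : ℕ, ((List.range' r k).sum : ℚ) = k * r + k * (k - 1) / 2 := by
      intro k
      induction k with
      | zero => simp
      | succ k ih => intro r; rw [List.range'_succ, List.sum_cons]; push_cast [ih]; ring
    have h := key k r
    generalize (List.range' r k).sum = s at *
    qify at this ⊢
    rw [Nat.cast_choose_two] at this ⊢
    push_cast at this ⊢
    rw [h]
    linear_combination this

end PlaneTree

theorem blockInequalities_iff (X : ℕ → ℝ) (i j k : ℕ) :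
    (1 ≤ k → 1 ≤ X (i + k - 1) / 2 ^ (j + k - 1) ∧
      (∀ m, m + 1 < k → X (i + m + 1) / 2 ^ (j + m + 1) ≤ X (i + m) / 2 ^ (j + m)) ∧
      X i / 2 ^ j ≤ 2) ↔
    ∀ m < k, (2 ^ (j + m) ≤ X (i + m) ∧ X (i + m) ≤ 2 ^ (j + m + 1)) ∧
      (m + 1 < k → X (i + m + 1) ≤ 2 * X (i + m)) := by
  have link : ∀ m, X (i + m + 1) / 2 ^ (j + m + 1) ≤ X (i + m) / 2 ^ (j + m) ↔
      X (i + m + 1) ≤ 2 * X (i + m) := fun m => by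
    rw [div_le_div_iff₀ (by positivity) (by positivity), pow_succ]
    have : (0 : ℝ) < 2 ^ (j + m) := by positivity
    constructor
    · intro h
      nlinarith
    · intro h
      nlinarith
  constructor
  · intro h m hm
    obtain ⟨h1, h2, h3⟩ := h (by omega)
    have up : ∀ m < k, X (i + m) / 2 ^ (j + m) ≤ 2 := by
      intro m
      induction m with
      | zero => intro _; simpa using h3
      | succ m ih => intro hm; exact (h2 m hm).trans (ih (by omega))
    have down : ∀ r m, m + r + 1 = k → 1 ≤ X (i + m) / 2 ^ (j + m) := by
      intro r
      induction r with
      | zero =>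
        intro m hm
        rwa [show i + k - 1 = i + m by omega, show j + k - 1 = j + m by omega] at h1
      | succ r ih => intro m hm; exact (ih (m + 1) (by omega)).trans (h2 m (by omega))
    have a := up m hm
    have b := down (k - 1 - m) m (by omega)
    rw [div_le_iff₀ (by positivity)] at a
    rw [le_div_iff₀ (by positivity), one_mul] at b
    exact ⟨⟨b, by rw [pow_succ, mul_comm]; exact a⟩, fun hm' => (link m).1 (h2 m hm')⟩
  · intro h hk
    refine ⟨?_, fun m hm => (link m).2 ((h m (by omega)).2 hm), ?_⟩
    · rw [le_div_iff₀ (by positivity), one_mul]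
      have := (h (k - 1) (by omega)).1.1
      rwa [show i + k - 1 = i + (k - 1) by omega, show j + k - 1 = j + (k - 1) by omega]
    · rw [div_le_iff₀ (by positivity)]
      have := (h 0 (by omega)).1.2
      rw [pow_succ, mul_comm] at this
      exact this

theorem getD_range'_append (a k p : ℕ) (L : List ℕ) :
    (List.range' a k ++ L).getD p 0 = if p < k then a + p else L.getD (p - k) 0 := by
  split_ifs with h
  · rw [List.getD_append _ _ _ _ (by simpa using h),
      List.getD_eq_getElem _ _ (by simpa using h)]
    simp
  · rw [List.getD_append_right _ _ _ _ (by simp; omega)]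
    simp

open PlaneTree in
theorem degBlocks_inequalities_iff (X : ℕ → ℝ) (ts : List PlaneTree) (i N : ℕ)
    (hN : (degSeqForest ts).sum = N) :
    (∀ b ∈ degBlocks (degSeqForest ts) i ts.length, 1 ≤ b.2.2 →
      1 ≤ X (b.1 + b.2.2 - 1) / 2 ^ (b.2.1 + b.2.2 - 1) ∧
      (∀ m, m + 1 < b.2.2 →
        X (b.1 + m + 1) / 2 ^ (b.2.1 + m + 1) ≤ X (b.1 + m) / 2 ^ (b.2.1 + m)) ∧
      X b.1 / 2 ^ b.2.1 ≤ 2) ↔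
    ∀ p < N, (2 ^ (exponents (degSeqForest ts) ts.length).getD p 0 ≤ X (i + p) ∧
      X (i + p) ≤ 2 ^ ((exponents (degSeqForest ts) ts.length).getD p 0 + 1)) ∧
      (p + 1 < N → X (i + p + 1) ≤ 2 * X (i + p)) := by
  induction ts using forest_induction generalizing i N with
  | nil => simp [degSeqForest] at hN; simp [degSeqForest, degBlocks, ← hN]
  | node_cons ts rest ih =>
    rw [degSeqForest_node_cons] at hN ⊢
    obtain ⟨M, hM⟩ : ∃ M, (degSeqForest (ts ++ rest)).sum = M := ⟨_, rfl⟩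
    have hh := headLT_exponents (ts ++ rest)
    have := ih (i + ts.length) M hM
    have hlen := length_exponents (degSeqForest (ts ++ rest)) (ts ++ rest).length
    rw [hM] at hlen
    rw [List.sum_cons, hM] at hN
    simp only [List.length_append, add_comm ts.length rest.length] at this hh hlen
    simp only [degBlocks, exponents, List.length_cons, Nat.add_sub_cancel, List.forall_mem_cons,
      this, getD_range'_append]
    rw [blockInequalities_iff X i rest.length ts.length]
    generalize exponents (degSeqForest (ts ++ rest)) (rest.length + ts.length) = L at *
    generalize ts.length = k at *
    generalize rest.length = r at *
    subst hN
    constructor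
    · rintro ⟨h1, h2⟩ p hp
      split_ifs with hpk
      · refine ⟨(h1 p hpk).1, fun hp' => ?_⟩
        by_cases hp2 : p + 1 < k
        · exact (h1 p hpk).2 hp2
        · have hM0 : 0 < M := by omega
          have hb := (h2 0 hM0).1.2
          rw [show i + k + 0 = i + p + 1 by omega] at hb
          have ha := (h1 p hpk).1.1
          have hL : L.getD 0 0 < r + k := by
            rcases L with _ | ⟨a, L⟩
            · simp at hlen; omega
            · exact hh a (by simp)
          calc X (i + p + 1) ≤ 2 ^ (L.getD 0 0 + 1) := hb
            _ ≤ 2 ^ (r + p + 1) := pow_le_pow_right₀ (by norm_num) (by omega)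
            _ ≤ 2 * X (i + p) := by rw [pow_succ]; linarith
      · have := h2 (p - k) (by omega)
        rw [show i + k + (p - k) = i + p by omega] at this
        exact ⟨this.1, fun hp' => this.2 (by omega)⟩
    · intro h
      refine ⟨fun m hm => ?_, fun p hp => ?_⟩
      · have := h m (by omega)
        rw [if_pos hm] at this
        exact ⟨this.1, fun hm' => this.2 (by omega)⟩
      · have := h (k + p) (by omega)
        rw [if_neg (by omega), show k + p - k = p by omega, ← add_assoc] at this
        exact ⟨this.1, fun hp' => this.2 (by omega)⟩

theorem coord_zero {n : ℕ} (x : Fin n → ℝ) : coord x 0 = 1 := by simp [coord]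

theorem coord_succ {n : ℕ} (x : Fin n → ℝ) (i : Fin n) : coord x (i + 1) = x i := by
  rw [coord, dif_pos ⟨by omega, i.2⟩]
  rfl

theorem coord_val {n : ℕ} (x : Fin n → ℝ) (i : Fin (n + 1)) :
    coord x i = (Fin.cons 1 x : Fin (n + 1) → ℝ) i := by
  refine Fin.cases ?_ (fun i => ?_) i
  · simp [coord_zero]
  · simpa using coord_succ x i

/-- The points `x` with `2 ^ e_i ≤ x_i ≤ 2 ^ (e_i + 1)` for the terms `e_i` of the list `L`, and
`x_i ≤ 2 x_{i-1}`, where `x_0 = u`. -/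
def dyadicCell (n : ℕ) (L : List ℕ) (u : ℝ) : Set (Fin n → ℝ) :=
  {x | ∀ i : Fin n, (2 ^ L.getD i 0 ≤ x i ∧ x i ≤ 2 ^ (L.getD i 0 + 1)) ∧
    x i ≤ 2 * (Fin.cons u x : Fin (n + 1) → ℝ) i.castSucc}

theorem mem_dyadicCell_one {n : ℕ} {L : List ℕ} {x : Fin n → ℝ} :
    x ∈ dyadicCell n L 1 ↔ ∀ p < n, (2 ^ L.getD p 0 ≤ coord x (p + 1) ∧
      coord x (p + 1) ≤ 2 ^ (L.getD p 0 + 1)) ∧ coord x (p + 1) ≤ 2 * coord x p := by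
  constructor
  · intro h p hp
    have := h ⟨p, hp⟩
    rwa [← coord_val, ← coord_succ x ⟨p, hp⟩] at this
  · intro h i
    have := h i i.2
    rwa [← coord_val, ← coord_succ x i]

theorem mem_cayleyPolytope {n : ℕ} {x : Fin n → ℝ} :
    x ∈ cayleyPolytope n ↔ ∀ p < n, 1 ≤ coord x (p + 1) ∧ coord x (p + 1) ≤ 2 * coord x p := by
  constructor
  · intro h p hp
    simpa using h (p + 1) (by omega) (by omega)
  · intro h i h1 h2
    have := h (i - 1) (by omega)
    rwa [Nat.sub_add_cancel h1] at this

theorem treePolytope_eq_dyadicCell (n : ℕ) (T : PlaneTree) (hT : T.numNodes = n + 1) :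
    treePolytope n T = dyadicCell n (PlaneTree.exponents T.degSeq 1) 1 := by
  have hlen := PlaneTree.length_exponents_degSeq T
  have hsum : T.degSeq.sum = n := by
    rw [PlaneTree.length_exponents] at hlen; omega
  have hhead := PlaneTree.headLT_exponents [T]
  ext x
  have := degBlocks_inequalities_iff (coord x) [T] 1 n (by simpa [PlaneTree.degSeqForest])
  simp only [PlaneTree.degSeqForest_singleton, List.length_singleton] at this hhead
  have h1 : x ∈ treePolytope n T ↔ _ := Iff.trans
    (by simp only [treePolytope, Set.mem_ofPred_eq, PlaneTree.blocks_eq_degBlocks, Prod.forall,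
      zero_add]) this
  rw [h1, mem_dyadicCell_one]
  generalize PlaneTree.exponents T.degSeq 1 = L at *
  have hL0 : L.getD 0 0 = 0 := by
    rcases L with _ | ⟨a, L⟩
    · rfl
    · simpa using hhead a (by simp)
  constructor
  · intro h p hp
    have hp' := h p hp
    rw [add_comm 1 p] at hp'
    refine ⟨hp'.1, ?_⟩
    rcases p with _ | p
    · rw [coord_zero]
      have := hp'.1.2
      rw [hL0] at this
      simpa using this
    · have := (h p (by omega)).2 hp
      rwa [add_comm 1 p] at this
  · intro h p hp
    rw [add_comm 1 p]
    exact ⟨(h p hp).1, fun hp' => (h (p + 1) hp').2⟩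

theorem dyadicCell_subset_cayleyPolytope (n : ℕ) (L : List ℕ) :
    dyadicCell n L 1 ⊆ cayleyPolytope n := by
  intro x hx
  rw [mem_dyadicCell_one] at hx
  rw [mem_cayleyPolytope]
  exact fun p hp => ⟨(one_le_pow₀ (by norm_num)).trans (hx p hp).1.1, (hx p hp).2⟩

theorem exists_dyadic (x : ℝ) (hx : 1 ≤ x) :
    ∃ e : ℕ, 2 ^ e ≤ x ∧ x ≤ 2 ^ (e + 1) ∧ ∀ m : ℕ, x ≤ 2 ^ (m + 1) → e ≤ m := by
  classical
  have hex : ∃ m : ℕ, x ≤ 2 ^ (m + 1) := by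
    obtain ⟨m, hm⟩ := pow_unbounded_of_one_lt x (one_lt_two (α := ℝ))
    exact ⟨m, hm.le.trans (pow_le_pow_right₀ (by norm_num) (by omega))⟩
  refine ⟨Nat.find hex, ?_, Nat.find_spec hex, fun m hm => Nat.find_min' hex hm⟩
  rcases h : Nat.find hex with _ | e
  · simpa using hx
  · exact (not_le.1 (Nat.find_min hex (m := e) (by omega))).le

theorem exists_dyadicCell {n : ℕ} {x : Fin n → ℝ} (hx : x ∈ cayleyPolytope n) :
    ∃ L : List ℕ, L.length = n ∧ PlaneTree.SlowGrowth L ∧ PlaneTree.HeadLT L 1 ∧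
      x ∈ dyadicCell n L 1 := by
  rw [mem_cayleyPolytope] at hx
  have hx1 : ∀ p, 1 ≤ coord x (p + 1) := by
    intro p
    by_cases hp : p < n
    · exact (hx p hp).1
    · rw [coord, dif_neg (by omega)]
  choose e he using fun p => exists_dyadic _ (hx1 p)
  refine ⟨(List.range n).map e, by simp, ?_, ?_, ?_⟩
  · rw [PlaneTree.SlowGrowth, List.isChain_iff_getElem]
    intro i hi
    simp only [List.length_map, List.length_range] at hi
    simp only [List.getElem_map, List.getElem_range]
    apply (he (i + 1)).2.2
    have h1 := (hx (i + 1) hi).2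
    have h2 := (he i).2.1
    rw [pow_succ]
    linarith
  · intro a ha
    rcases n with _ | n
    · simp at ha
    · simp [List.range_succ_eq_map] at ha
      subst ha
      rw [Nat.lt_one_iff, ← Nat.le_zero]
      apply (he 0).2.2
      have := (hx 0 (by omega)).2
      rw [coord_zero] at this
      simpa using this
  · rw [mem_dyadicCell_one]
    intro p hp
    have : ((List.range n).map e).getD p 0 = e p := by
      rw [List.getD_eq_getElem _ _ (by simpa using hp)]; simp
    rw [this]
    exact ⟨⟨(he p).1, (he p).2.1⟩, (hx p hp).2⟩

theorem iUnion_treePolytope (n : ℕ) :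
    ⋃ T : {T : PlaneTree // T.numNodes = n + 1}, treePolytope n T.1 = cayleyPolytope n := by
  refine Set.Subset.antisymm (Set.iUnion_subset fun T => ?_) fun x hx => ?_
  · rw [treePolytope_eq_dyadicCell n T.1 T.2]
    exact dyadicCell_subset_cayleyPolytope n _
  · obtain ⟨L, h1, h2, h3, h4⟩ := exists_dyadicCell hx
    obtain ⟨T, hT, hL⟩ := PlaneTree.exists_tree_of_slowGrowth L h2 h3
    rw [h1] at hT
    refine Set.mem_iUnion.2 ⟨⟨T, hT⟩, ?_⟩
    rwa [treePolytope_eq_dyadicCell n T hT, hL]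

theorem mem_dyadicCell_iff_of_mem {n : ℕ} {L M : List ℕ} {u : ℝ} {x : Fin n → ℝ}
    (hx : x ∈ dyadicCell n L u) :
    x ∈ dyadicCell n M u ↔ ∀ i : Fin n, 2 ^ M.getD i 0 ≤ x i ∧ x i ≤ 2 ^ (M.getD i 0 + 1) :=
  ⟨fun h i => (h i).1, fun h i => ⟨h i, (hx i).2⟩⟩

theorem dyadic_dichotomy {x : ℝ} {a b : ℕ} (ha : 2 ^ a ≤ x ∧ x ≤ 2 ^ (a + 1))
    (hb : 2 ^ b ≤ x ∧ x ≤ 2 ^ (b + 1)) (hab : a < b) : b = a + 1 ∧ x = 2 ^ b := by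
  have h : b ≤ a + 1 := by
    have := hb.1.trans ha.2
    exact (pow_le_pow_iff_right₀ (by norm_num : (1 : ℝ) < 2)).1 this
  obtain rfl : b = a + 1 := by omega
  exact ⟨rfl, le_antisymm ha.2 hb.1⟩

open MeasureTheory in
theorem volume_dyadicCell_inter {n : ℕ} {L M : List ℕ} (u : ℝ) (hL : L.length = n)
    (hM : M.length = n) (hne : L ≠ M) :
    volume (dyadicCell n L u ∩ dyadicCell n M u) = 0 := by
  obtain ⟨i, hi⟩ : ∃ i : Fin n, L.getD i 0 ≠ M.getD i 0 := by
    by_contra! h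
    refine hne (List.ext_getElem (hL.trans hM.symm) fun i h1 h2 => ?_)
    have := h ⟨i, hL ▸ h1⟩
    rwa [List.getD_eq_getElem _ _ h1, List.getD_eq_getElem _ _ h2] at this
  refine measure_mono_null (t := {x | x i = 2 ^ max (L.getD i 0) (M.getD i 0)}) ?_
    (Measure.pi_hyperplane (fun _ => volume) i _)
  rintro x ⟨h1, h2⟩
  rcases hi.lt_or_gt with h | h
  · rw [Set.mem_ofPred_eq, max_eq_right h.le]
    exact (dyadic_dichotomy (h1 i).1 (h2 i).1 h).2
  · rw [Set.mem_ofPred_eq, max_eq_left h.le]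
    exact (dyadic_dichotomy (h2 i).1 (h1 i).1 h).2

theorem isExposed_dyadicCell_inter (n : ℕ) (L M : List ℕ) (u : ℝ) :
    IsExposed ℝ (dyadicCell n L u) (dyadicCell n L u ∩ dyadicCell n M u) := by
  rintro ⟨z, hzL, hzM⟩
  let s : Fin n → ℝ := fun i =>
    if L.getD i 0 < M.getD i 0 then 1 else if M.getD i 0 < L.getD i 0 then -1 else 0
  have hmax : ∀ i, ∀ y ∈ dyadicCell n L u, s i * y i ≤ s i * z i := by
    intro i y hy
    simp only [s]
    split_ifs with h1 h2
    · obtain ⟨h3, h4⟩ := dyadic_dichotomy (hzL i).1 (hzM i).1 h1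
      have := (hy i).1.2
      rw [← h3] at this
      linarith
    · have h4 := (dyadic_dichotomy (hzM i).1 (hzL i).1 h2).2
      have := (hy i).1.1
      linarith
    · simp
  have heq : ∀ x ∈ dyadicCell n L u, (∀ i, s i * x i = s i * z i) → x ∈ dyadicCell n M u := by
    intro x hx h
    rw [mem_dyadicCell_iff_of_mem hx]
    intro i
    have hi := h i
    simp only [s] at hi
    split_ifs at hi with h1 h2
    · have : x i = z i := by linarith
      rw [this]; exact (hzM i).1
    · have : x i = z i := by linarith
      rw [this]; exact (hzM i).1
    · rw [show M.getD i 0 = L.getD i 0 by omega]; exact (hx i).1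
  have heq' : ∀ x ∈ dyadicCell n L u, x ∈ dyadicCell n M u → ∀ i, s i * x i = s i * z i := by
    intro x hx hx' i
    simp only [s]
    split_ifs with h1 h2
    · rw [(dyadic_dichotomy (hzL i).1 (hzM i).1 h1).2, (dyadic_dichotomy (hx i).1 (hx' i).1 h1).2]
    · rw [(dyadic_dichotomy (hzM i).1 (hzL i).1 h2).2, (dyadic_dichotomy (hx' i).1 (hx i).1 h2).2]
    · simp
  let l : StrongDual ℝ (Fin n → ℝ) := ∑ i, s i • ContinuousLinearMap.proj i
  have hl : ∀ x, l x = ∑ i, s i * x i := fun x => by simp [l]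
  refine ⟨l, Set.Subset.antisymm ?_ ?_⟩
  · rintro x ⟨hxL, hxM⟩
    refine ⟨hxL, fun y hy => ?_⟩
    rw [hl, hl]
    exact Finset.sum_le_sum fun i _ => by rw [heq' x hxL hxM]; exact hmax i y hy
  · rintro x ⟨hxL, hx⟩
    refine ⟨hxL, heq x hxL fun i => ?_⟩
    have h := hx z hzL
    rw [hl, hl] at h
    have h2 := Finset.sum_le_sum fun i (_ : i ∈ Finset.univ) => hmax i x hxL
    exact (Finset.sum_eq_sum_iff_of_le fun i _ => hmax i x hxL).1 (le_antisymm h2 h) i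
      (Finset.mem_univ i)

/-- A bounded set described by finitely many linear inequalities is a polytope. -/
theorem isPolytope_of_inequalities {n : ℕ} {ι : Type*} [Finite ι]
    (l : ι → (Fin n → ℝ) →L[ℝ] ℝ) (c : ι → ℝ)
    (hb : Bornology.IsBounded {x | ∀ i, l i x ≤ c i}) : IsPolytope {x | ∀ i, l i x ≤ c i} := by
  set P : Set (Fin n → ℝ) := {x | ∀ i, l i x ≤ c i} with hP
  have hclosed : IsClosed P := by
    rw [hP, Set.ofPred_forall]
    exact isClosed_iInter fun i => isClosed_le (l i).continuous continuous_const
  have hconv : Convex ℝ P := by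
    rw [hP, Set.ofPred_forall]
    exact convex_iInter fun i => convex_halfSpace_le (l i).toLinearMap.isLinear _
  have hcompact : IsCompact P := Metric.isCompact_of_isClosed_isBounded hclosed hb
  have hfin : (P.extremePoints ℝ).Finite := by
    refine Set.Finite.of_injOn (f := fun x => {i | l i x = c i}) (t := Set.univ)
      (fun _ _ => Set.mem_univ _) ?_ Set.finite_univ
    intro x hx y hy hxy
    have hxP : x ∈ P := hx.1
    have key : ∀ᶠ t in nhds (0 : ℝ), x + t • (y - x) ∈ P := by
      simp only [hP, Set.mem_ofPred_eq, Filter.eventually_all]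
      intro i
      by_cases hi : l i x = c i
      · have hi' : l i y = c i := by
          have : i ∈ {i | l i x = c i} := hi
          have hxy' : {i | l i x = c i} = {i | l i y = c i} := hxy
          rw [hxy'] at this
          exact this
        exact Filter.Eventually.of_forall fun t => by simp [hi, hi']
      · have hlt : l i x < c i := lt_of_le_of_ne (hxP i) hi
        have hcont : Continuous fun t : ℝ => l i (x + t • (y - x)) := by fun_prop
        have := hcont.continuousAt.eventually_lt (continuousAt_const (x := (0 : ℝ)) (y := c i))
          (by simpa using hlt)
        exact this.mono fun t ht => ht.le
    obtain ⟨ε, hε, h⟩ := Metric.eventually_nhds_iff.1 key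
    have h1 := h (y := ε / 2) (by simp [abs_of_pos hε]; linarith)
    have h2 := h (y := -(ε / 2)) (by simp [abs_of_pos hε]; linarith)
    have h3 : x ∈ openSegment ℝ (x + (ε / 2) • (y - x)) (x + (-(ε / 2)) • (y - x)) := by
      refine ⟨1 / 2, 1 / 2, by norm_num, by norm_num, by norm_num, ?_⟩
      ext j
      simp
      ring
    have h4 := hx.2 h1 h2 h3
    have h5 : (ε / 2) • (y - x) = 0 := by simpa using h4
    have h6 := (smul_eq_zero.1 h5).resolve_left (by positivity)
    exact (sub_eq_zero.1 h6).symm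
  refine ⟨P.extremePoints ℝ, hfin, ?_⟩
  rw [← (hfin.isClosed_convexHull ℝ).closure_eq]
  exact (closure_convexHull_extremePoints hcompact hconv).symm

theorem isBounded_dyadicCell (n : ℕ) (L : List ℕ) (u : ℝ) :
    Bornology.IsBounded (dyadicCell n L u) :=
  (Metric.isBounded_Icc (fun i : Fin n => (2 : ℝ) ^ L.getD i 0)
    (fun i => 2 ^ (L.getD i 0 + 1))).subset fun _ hx =>
    ⟨fun i => (hx i).1.1, fun i => (hx i).1.2⟩

theorem dyadicCell_eq_inequalities (n : ℕ) (L : List ℕ) (u : ℝ) :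
    ∃ (l : Fin n × Fin 3 → (Fin n → ℝ) →L[ℝ] ℝ) (c : Fin n × Fin 3 → ℝ),
      dyadicCell n L u = {x | ∀ i, l i x ≤ c i} := by
  let π : Fin n → (Fin n → ℝ) →L[ℝ] ℝ := fun i => ContinuousLinearMap.proj i
  let prev : Fin n → (Fin n → ℝ) →L[ℝ] ℝ := fun i =>
    (Fin.cons 0 π : Fin (n + 1) → _) i.castSucc
  let start : Fin n → ℝ := fun i => (Fin.cons u 0 : Fin (n + 1) → ℝ) i.castSucc
  have hprev : ∀ i x, (Fin.cons u x : Fin (n + 1) → ℝ) i.castSucc = start i + prev i x := by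
    intro i x
    simp only [start, prev]
    refine Fin.cases ?_ (fun j => ?_) i.castSucc
    · simp
    · simp [π]
  refine ⟨fun i => ![-π i.1, π i.1, π i.1 - 2 • prev i.1] i.2,
    fun i => ![-2 ^ L.getD i.1 0, 2 ^ (L.getD i.1 0 + 1), 2 * start i.1] i.2, ?_⟩
  ext x
  simp only [dyadicCell, Set.mem_ofPred_eq, hprev, Prod.forall, Fin.forall_fin_succ (n := 2),
    Fin.forall_fin_two]
  refine forall_congr' fun i => ?_
  simp only [π, ContinuousLinearMap.proj_apply, Matrix.cons_val_zero,
    Fin.succ_zero_eq_one, Fin.succ_one_eq_two, Matrix.cons_val_one, Matrix.cons_val_two,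
    Matrix.tail_cons, Matrix.head_cons, neg_apply, neg_le_neg_iff,
    sub_apply, smul_apply, nsmul_eq_mul, Nat.cast_ofNat]
  rw [and_assoc]
  refine and_congr Iff.rfl (and_congr Iff.rfl ?_)
  constructor <;> intro h <;> linarith

theorem isPolytope_dyadicCell (n : ℕ) (L : List ℕ) (u : ℝ) : IsPolytope (dyadicCell n L u) := by
  obtain ⟨l, c, h⟩ := dyadicCell_eq_inequalities n L u
  have hb := isBounded_dyadicCell n L u
  rw [h] at hb ⊢
  exact isPolytope_of_inequalities l c hb

theorem convex_dyadicCell (n : ℕ) (L : List ℕ) (u : ℝ) : Convex ℝ (dyadicCell n L u) := by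
  obtain ⟨V, -, h⟩ := isPolytope_dyadicCell n L u
  rw [h]
  exact convex_convexHull ℝ V

theorem isClosed_dyadicCell (n : ℕ) (L : List ℕ) (u : ℝ) : IsClosed (dyadicCell n L u) := by
  obtain ⟨V, hV, h⟩ := isPolytope_dyadicCell n L u
  rw [h]
  exact hV.isClosed_convexHull ℝ

open MeasureTheory in
theorem interior_nonempty_of_volume_ne_zero {n : ℕ} {P : Set (Fin n → ℝ)} (hP : Convex ℝ P)
    (hv : volume P ≠ 0) : (interior P).Nonempty := by
  by_contra h
  rw [Set.not_nonempty_iff_eq_empty] at h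
  refine hv (measure_mono_null ?_ (hP.addHaar_frontier volume))
  rw [frontier, h, Set.sdiff_empty]
  exact subset_closure

open MeasureTheory in
theorem disjoint_interior_of_volume_inter {n : ℕ} {P Q : Set (Fin n → ℝ)}
    (h : volume (P ∩ Q) = 0) : Disjoint (interior P) (interior Q) := by
  rw [Set.disjoint_iff_inter_eq_empty, ← interior_inter]
  exact isOpen_interior.eq_empty_of_measure_zero (measure_mono_null interior_subset h)

/-- The number of terms at the start of the list `L` that continue the run `a, a + 1, …`. -/
def leadingRun : List ℕ → ℕ → ℕ
  | [], _ => 0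
  | b :: L, a => if b = a + 1 then leadingRun L b + 1 else 0

/-- The volume of the dyadic cell with exponents `L`, when its first coordinate is not restricted
by an earlier one. -/
noncomputable def cellVolume : List ℕ → ℝ
  | [] => 1
  | b :: L => cellVolume L * (2 ^ b / (leadingRun L b + 1))

theorem cellVolume_pos (L : List ℕ) : 0 < cellVolume L := by
  induction L with
  | nil => simp [cellVolume]
  | cons b L ih => rw [cellVolume]; positivity

theorem integral_dyadic_pow (b m : ℕ) (c R : ℝ) :
    ∫ y in (2 : ℝ) ^ b..R, c * (y / 2 ^ b - 1) ^ m =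
      c * (2 ^ b / (m + 1)) * (R / 2 ^ b - 1) ^ (m + 1) := by
  have hd : ∀ y ∈ Set.uIcc ((2 : ℝ) ^ b) R,
      HasDerivAt (fun y => c * (2 ^ b / (m + 1)) * (y / 2 ^ b - 1) ^ (m + 1))
        (c * (y / 2 ^ b - 1) ^ m) y := by
    intro y _
    have h1 : HasDerivAt (fun y : ℝ => y / 2 ^ b - 1) (1 / 2 ^ b) y :=
      ((hasDerivAt_id y).div_const _).sub_const _
    have h2 := (h1.pow (m + 1)).const_mul (c * ((2 : ℝ) ^ b / (m + 1)))
    refine h2.congr_deriv ?_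
    have : (m : ℝ) + 1 ≠ 0 := by positivity
    simp only [Nat.add_sub_cancel]
    push_cast
    field_simp
  rw [intervalIntegral.integral_eq_sub_of_hasDerivAt hd
    (by apply Continuous.intervalIntegrable; fun_prop)]
  rw [div_self (by positivity)]
  simp

open MeasureTheory in
theorem lintegral_dyadic_pow (b m : ℕ) {c R : ℝ} (hc : 0 ≤ c) (hR : 2 ^ b ≤ R) :
    ∫⁻ y in Set.Icc ((2 : ℝ) ^ b) R, ENNReal.ofReal (c * (y / 2 ^ b - 1) ^ m) =
      ENNReal.ofReal (c * (2 ^ b / (m + 1)) * (R / 2 ^ b - 1) ^ (m + 1)) := by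
  rw [← integral_dyadic_pow, intervalIntegral.integral_of_le hR, ← integral_Icc_eq_integral_Ioc,
    ofReal_integral_eq_lintegral_ofReal]
  · exact (Continuous.continuousOn (by fun_prop)).integrableOn_Icc
  · refine (ae_restrict_iff' measurableSet_Icc).2 (Filter.Eventually.of_forall fun y hy => ?_)
    have : 0 ≤ y / 2 ^ b - 1 := by
      rw [sub_nonneg, le_div_iff₀ (by positivity), one_mul]; exact hy.1
    exact mul_nonneg hc (pow_nonneg this m)

theorem cons_mem_dyadicCell {n b : ℕ} {L : List ℕ} {u y : ℝ} {z : Fin n → ℝ} :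
    (Fin.cons y z : Fin (n + 1) → ℝ) ∈ dyadicCell (n + 1) (b :: L) u ↔
      ((2 ^ b ≤ y ∧ y ≤ 2 ^ (b + 1)) ∧ y ≤ 2 * u) ∧ z ∈ dyadicCell n L y := by
  simp only [dyadicCell, Set.mem_ofPred_eq, Fin.forall_fin_succ (n := n)]
  rfl

open MeasureTheory in
theorem volume_dyadicCell (L : List ℕ) : ∀ (n a : ℕ) (u : ℝ), L.length = n →
    PlaneTree.SlowGrowth (a :: L) → 2 ^ a ≤ u → u ≤ 2 ^ (a + 1) →
    volume (dyadicCell n L u) =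
      ENNReal.ofReal (cellVolume L * (u / 2 ^ a - 1) ^ leadingRun L a) := by
  induction L with
  | nil =>
    rintro n a u rfl _ _ _
    have : dyadicCell 0 [] u = Set.univ := Set.eq_univ_of_forall fun x i => i.elim0
    simp [List.length_nil, this, cellVolume, leadingRun, volume_pi]
  | cons b L ih =>
    rintro n a u rfl hL hu1 hu2
    obtain ⟨hab, hL'⟩ := List.isChain_cons_cons.1 hL
    rw [List.length_cons]
    set R : ℝ := if b = a + 1 then 2 * u else 2 ^ (b + 1) with hR
    have hRmem : ∀ y : ℝ, ((2 ^ b ≤ y ∧ y ≤ 2 ^ (b + 1)) ∧ y ≤ 2 * u) ↔ y ∈ Set.Icc (2 ^ b) R := by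
      intro y
      rw [and_assoc, Set.mem_Icc, hR]
      refine and_congr Iff.rfl ?_
      split_ifs with h
      · refine ⟨fun h => h.2, fun h' => ⟨h'.trans ?_, h'⟩⟩
        rw [h, pow_succ]; linarith
      · refine ⟨fun h => h.1, fun h' => ⟨h', h'.trans ?_⟩⟩
        have : (2 : ℝ) ^ (b + 1) ≤ 2 ^ (a + 1) := pow_le_pow_right₀ (by norm_num) (by omega)
        rw [pow_succ 2 a] at this
        linarith
    have hbR : 2 ^ b ≤ R := by
      rw [hR]
      split_ifs with h
      · rw [h, pow_succ]; linarith
      · exact pow_le_pow_right₀ (by norm_num) (by omega)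
    set e := MeasurableEquiv.piFinSuccAbove (fun _ : Fin (L.length + 1) => ℝ) 0
    have he : MeasurePreserving e.symm := (volume_preserving_piFinSuccAbove (fun _ => ℝ) 0).symm e
    rw [← he.measure_preimage_equiv, Measure.volume_eq_prod,
      Measure.prod_apply (e.symm.measurable (isClosed_dyadicCell _ _ _).measurableSet)]
    have hslice : ∀ y : ℝ, volume (Prod.mk y ⁻¹' (e.symm ⁻¹' dyadicCell (L.length + 1) (b :: L) u)) =
        (Set.Icc ((2 : ℝ) ^ b) R).indicator
          (fun y => ENNReal.ofReal (cellVolume L * (y / 2 ^ b - 1) ^ leadingRun L b)) y := by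
      intro y
      have hcons : ∀ z : Fin L.length → ℝ, e.symm (y, z) = (Fin.cons y z : Fin _ → ℝ) := fun z => by
        simp [e, MeasurableEquiv.piFinSuccAbove, Fin.insertNthEquiv]
      have hset : Prod.mk y ⁻¹' (e.symm ⁻¹' dyadicCell (L.length + 1) (b :: L) u) =
          {z | y ∈ Set.Icc ((2 : ℝ) ^ b) R ∧ z ∈ dyadicCell L.length L y} := by
        ext z
        rw [Set.mem_preimage, Set.mem_preimage, hcons, cons_mem_dyadicCell, hRmem]
        rfl
      rw [hset]
      by_cases hy : y ∈ Set.Icc ((2 : ℝ) ^ b) R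
      · have h2 := ((hRmem y).2 hy).1
        rw [Set.indicator_of_mem hy, ← ih L.length b y rfl hL' h2.1 h2.2]
        simp [hy]
      · rw [Set.indicator_of_notMem hy]
        simp [hy]
    simp_rw [hslice]
    rw [lintegral_indicator measurableSet_Icc, lintegral_dyadic_pow _ _ (cellVolume_pos L).le hbR,
      cellVolume, leadingRun, hR]
    split_ifs with h
    · rw [h, pow_succ 2 a, mul_comm _ (2 : ℝ), mul_div_mul_left _ _ two_ne_zero]
    · rw [pow_succ 2 b, mul_div_cancel_left₀ _ (by positivity : (2 : ℝ) ^ b ≠ 0)]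
      norm_num

theorem leadingRun_range'_append (b k : ℕ) (L : List ℕ)
    (hL : PlaneTree.HeadLT L (b + 1 + k)) :
    leadingRun (List.range' (b + 1) k ++ L) b = k := by
  induction k generalizing b with
  | zero =>
    cases L with
    | nil => simp [leadingRun]
    | cons a L => have := hL a (by simp); simp [leadingRun]; omega
  | succ k ih =>
    rw [List.range'_succ, List.cons_append, leadingRun, if_pos rfl,
      ih (b + 1) (by convert hL using 1; omega)]

theorem cellVolume_range'_append (b k : ℕ) (L : List ℕ) (hL : PlaneTree.HeadLT L (b + k)) :
    cellVolume (List.range' b k ++ L) * k ! = cellVolume L * 2 ^ (List.range' b k).sum := by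
  induction k generalizing b with
  | zero => simp
  | succ k ih =>
    have h : PlaneTree.HeadLT L (b + 1 + k) := by convert hL using 1; omega
    rw [List.range'_succ, List.cons_append, cellVolume, leadingRun_range'_append _ _ _ h,
      List.sum_cons, pow_add, Nat.factorial_succ]
    have := ih (b + 1) h
    push_cast
    have hk : (k : ℝ) + 1 ≠ 0 := by positivity
    field_simp
    linear_combination this

open PlaneTree in
theorem cellVolume_exponents (ts : List PlaneTree) :
    cellVolume (exponents (degSeqForest ts) ts.length) *
        (((degSeqForest ts).map Nat.factorial).prod : ℕ) =
      2 ^ (exponents (degSeqForest ts) ts.length).sum := by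
  induction ts using forest_induction with
  | nil => simp [degSeqForest, exponents, cellVolume]
  | node_cons ts rest ih =>
    have hh := headLT_exponents (ts ++ rest)
    rw [degSeqForest_node_cons]
    simp only [exponents, List.length_cons, Nat.add_sub_cancel, List.map_cons, List.prod_cons,
      List.sum_append, pow_add, List.length_append, add_comm ts.length rest.length] at ih hh ⊢
    have := cellVolume_range'_append rest.length ts.length _ hh
    push_cast at ih ⊢
    rw [← mul_assoc, this, ← ih]
    ring

open PlaneTree in
theorem cellVolume_mul_eq (n : ℕ) (T : PlaneTree) (hT : T.numNodes = n + 1) :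
    cellVolume (exponents T.degSeq 1) * ((T.degSeq.map Nat.factorial).prod : ℕ) *
      2 ^ weightedSum T.degSeq = 2 ^ (n + 1).choose 2 := by
  have h1 := cellVolume_exponents [T]
  have hs := sum_degSeqForest [T]
  have h2 := sum_exponents_add_weightedSum [T] n (by
    rw [numNodesForest_singleton] at hs; simp at hs ⊢; omega)
  simp only [degSeqForest_singleton, List.length_singleton] at h1 h2
  rw [h1, ← pow_add]
  congr 1
  omega

open MeasureTheory PlaneTree in
theorem volume_treePolytope (n : ℕ) (T : PlaneTree) (hT : T.numNodes = n + 1) :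
    volume (treePolytope n T) = ENNReal.ofReal (cellVolume (exponents T.degSeq 1)) := by
  have hlen := length_exponents_degSeq T
  have h1 := slowGrowth_exponents [T]
  have h2 := headLT_exponents [T]
  simp only [degSeqForest_singleton, List.length_singleton] at h1 h2
  rw [treePolytope_eq_dyadicCell n T hT, volume_dyadicCell _ n 0 1 (by omega)
    (List.isChain_cons.2 ⟨fun y hy => (h2 y hy).le, h1⟩) (by norm_num) (by norm_num)]
  have : leadingRun (exponents T.degSeq 1) 0 = 0 := by
    rcases h : exponents T.degSeq 1 with _ | ⟨a, L⟩
    · rfl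
    · have := h2 a (by simp [h])
      simp [leadingRun]; omega
  rw [this, pow_zero, mul_one]

open Classical in
/-- The nodes that are visited when `v` becomes active and `V` is the set of visited nodes. -/
noncomputable def newNeighbors {n : ℕ} (G : SimpleGraph (Fin (n + 1))) (V : Finset (Fin (n + 1)))
    (v : Fin (n + 1)) : Finset (Fin (n + 1)) :=
  Finset.univ.filter fun w => G.Adj v w ∧ w ∉ V

/-- The search that starts with the visited nodes `V` and the waiting nodes `W` stops after
`ds.length` steps, and the `i`-th active node has `ds[i]` successors. -/
def SearchDegrees {n : ℕ} (G : SimpleGraph (Fin (n + 1))) :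
    List ℕ → Finset (Fin (n + 1)) → List (Fin (n + 1)) → Prop
  | [], _, W => W = []
  | _ :: _, _, [] => False
  | k :: ds, V, v :: W => (newNeighbors G V v).card = k ∧
      SearchDegrees G ds (V ∪ newNeighbors G V v) ((newNeighbors G V v).sort (· ≤ ·) ++ W)

/-- The properties shared by all states of the search. -/
structure ValidState {n : ℕ} (G : SimpleGraph (Fin (n + 1))) (V : Finset (Fin (n + 1)))
    (W : List (Fin (n + 1))) : Prop where
  nodup : W.Nodup
  subset : ∀ a ∈ W, a ∈ V
  closed : ∀ a ∈ V, a ∉ W → ∀ b, G.Adj a b → b ∈ V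

section search

variable {n : ℕ} {G : SimpleGraph (Fin (n + 1))}

theorem mem_newNeighbors {V : Finset (Fin (n + 1))} {v w : Fin (n + 1)} :
    w ∈ newNeighbors G V v ↔ G.Adj v w ∧ w ∉ V := by
  simp [newNeighbors]

theorem disjoint_newNeighbors (V : Finset (Fin (n + 1))) (v : Fin (n + 1)) :
    Disjoint V (newNeighbors G V v) :=
  Finset.disjoint_right.2 fun _ h => (mem_newNeighbors.1 h).2

theorem step_eq {s : NFSState n} {v : Fin (n + 1)} {W : List (Fin (n + 1))}
    (h : s.waiting = v :: W) : NFSState.step G s =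
      { visited := s.visited ∪ newNeighbors G s.visited v
        waiting := (newNeighbors G s.visited v).sort (· ≤ ·) ++ W
        children := Function.update s.children v (newNeighbors G s.visited v) } := by
  rw [NFSState.step, h]
  rfl

theorem step_of_waiting_nil {s : NFSState n} (h : s.waiting = []) : NFSState.step G s = s := by
  rw [NFSState.step, h]

theorem ValidState.step {V : Finset (Fin (n + 1))} {v : Fin (n + 1)} {W : List (Fin (n + 1))}
    (h : ValidState G V (v :: W)) :
    ValidState G (V ∪ newNeighbors G V v) ((newNeighbors G V v).sort (· ≤ ·) ++ W) where
  nodup := by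
    refine List.Nodup.append (Finset.sort_nodup _ _) (List.nodup_cons.1 h.nodup).2 ?_
    intro a ha haW
    rw [Finset.mem_sort] at ha
    exact (mem_newNeighbors.1 ha).2 (h.subset a (List.mem_cons_of_mem _ haW))
  subset a ha := by
    rw [List.mem_append, Finset.mem_sort] at ha
    rw [Finset.mem_union]
    exact ha.elim Or.inr fun ha => Or.inl (h.subset a (List.mem_cons_of_mem _ ha))
  closed a ha haW b hab := by
    rw [List.mem_append, Finset.mem_sort, not_or] at haW
    rw [Finset.mem_union] at ha ⊢
    have haV := ha.resolve_right haW.1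
    by_cases hav : a = v
    · subst hav
      by_cases hb : b ∈ V
      · exact Or.inl hb
      · exact Or.inr (mem_newNeighbors.2 ⟨hab, hb⟩)
    · exact Or.inl (h.closed a haV (by simp [hav, haW.2]) b hab)

theorem children_iterate_step (r : ℕ) : ∀ (s : NFSState n), ValidState G s.visited s.waiting →
    ∀ a ∈ s.visited, a ∉ s.waiting →
      ((NFSState.step G)^[r] s).children a = s.children a := by
  induction r with
  | zero => intros; rfl
  | succ r ih =>
    intro s hs a haV haW
    rw [Function.iterate_succ_apply]
    rcases h : s.waiting with _ | ⟨v, W⟩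
    · rw [step_of_waiting_nil h]
      exact ih s hs a haV haW
    · rw [h] at hs haW
      have hne : a ≠ v := fun h => haW (by simp [h])
      rw [ih, step_eq h]
      · exact Function.update_of_ne hne _ _
      · rw [step_eq h]; exact hs.step
      · rw [step_eq h]; exact Finset.mem_union_left _ haV
      · rw [step_eq h]
        simp only [List.mem_append, Finset.mem_sort, not_or]
        exact ⟨fun h => (mem_newNeighbors.1 h).2 haV, fun h => haW (List.mem_cons_of_mem _ h)⟩

open PlaneTree in
theorem degSeqForest_eraseLabels (ds : List ℕ) : ∀ (s : NFSState n),
    ValidState G s.visited s.waiting → SearchDegrees G ds s.visited s.waiting →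
    ∀ D, ds.length ≤ D + 1 →
      degSeqForest (s.waiting.map
        (eraseLabels ((NFSState.step G)^[ds.length] s).children D)) = ds ∧
      ∀ D', ds.length ≤ D' + 1 → ∀ a ∈ s.waiting,
        eraseLabels ((NFSState.step G)^[ds.length] s).children D a =
          eraseLabels ((NFSState.step G)^[ds.length] s).children D' a := by
  induction ds with
  | nil =>
    intro s _ h D _
    rw [SearchDegrees] at h
    simp [h, degSeqForest]
  | cons k ds ih =>
    intro s hs h D hD
    rcases hw : s.waiting with _ | ⟨v, W⟩
    · rw [hw] at h; exact h.elim
    rw [hw] at hs h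
    obtain ⟨hk, h⟩ := h
    have hstep := step_eq (G := G) hw
    have hs' := hs.step
    rw [List.length_cons, Function.iterate_succ_apply]
    generalize hss : NFSState.step G s = s' at *
    have hV' : s'.visited = s.visited ∪ newNeighbors G s.visited v := by rw [hstep]
    have hW' : s'.waiting = (newNeighbors G s.visited v).sort (· ≤ ·) ++ W := by rw [hstep]
    rw [← hV', ← hW'] at hs' h
    have hih := ih s' hs' h
    set ch := ((NFSState.step G)^[ds.length] s').children
    have hv : ch v = newNeighbors G s.visited v := by
      have hvV := hs.subset v (by simp)
      have hvW' : v ∉ s'.waiting := by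
        rw [hW']
        simp only [List.mem_append, Finset.mem_sort, not_or]
        exact ⟨fun h => (mem_newNeighbors.1 h).2 hvV, (List.nodup_cons.1 hs.nodup).1⟩
      refine (children_iterate_step ds.length s' hs' v
        (by rw [hV']; exact Finset.mem_union_left _ hvV) hvW').trans ?_
      rw [hstep]
      exact Function.update_self ..
    have herase : ∀ D, ds.length ≤ D → eraseLabels ch D v =
        node (((newNeighbors G s.visited v).sort (· ≤ ·)).map (eraseLabels ch (D - 1))) := by
      intro D hD
      cases D with
      | zero =>
        obtain rfl : ds = [] := List.length_eq_zero_iff.1 (by omega)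
        rw [SearchDegrees, hW', List.append_eq_nil_iff] at h
        rw [h.1]
        rfl
      | succ D => rw [eraseLabels, hv]; rfl
    have hD' : ds.length ≤ D := by simpa using hD
    constructor
    · rw [List.map_cons, herase D hD', degSeqForest_node_cons, List.length_map, Finset.length_sort,
        hk]
      congr 1
      have hW : W.map (eraseLabels ch D) = W.map (eraseLabels ch (D - 1)) :=
        List.map_congr_left fun a ha =>
          (hih D (by omega)).2 (D - 1) (by omega) a (by rw [hW']; exact List.mem_append_right _ ha)
      rw [hW, ← List.map_append, ← hW']
      exact (hih (D - 1) (by omega)).1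
    · intro E hE a ha
      have hE' : ds.length ≤ E := by simpa using hE
      rcases List.mem_cons.1 ha with rfl | ha
      · rw [herase D hD', herase E hE']
        congr 1
        exact List.map_congr_left fun b hb => (hih (D - 1) (by omega)).2 (E - 1) (by omega) b
          (by rw [hW']; exact List.mem_append_left _ hb)
      · exact (hih D (by omega)).2 E (by omega) a (by rw [hW']; exact List.mem_append_right _ ha)

theorem eq_univ_of_closed (hG : G.Connected) {V : Finset (Fin (n + 1))} {r : Fin (n + 1)}
    (hr : r ∈ V) (h : ∀ a ∈ V, ∀ b, G.Adj a b → b ∈ V) : V = Finset.univ := by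
  refine Finset.eq_univ_of_forall fun b => ?_
  obtain ⟨p⟩ := hG.preconnected r b
  induction p with
  | nil => exact hr
  | cons hab _ ih => exact ih (h _ hr _ hab)

theorem exists_searchDegrees (hG : G.Connected) {r : Fin (n + 1)} (N : ℕ) :
    ∀ (V : Finset (Fin (n + 1))) (W : List (Fin (n + 1))), ValidState G V W → r ∈ V →
    N + V.card = n + 1 + W.length → ∃ ds, ds.length = N ∧ SearchDegrees G ds V W := by
  induction N with
  | zero =>
    intro V W h hr hN
    have := Finset.card_le_univ V
    rw [Fintype.card_fin] at this
    exact ⟨[], rfl, List.length_eq_zero_iff.1 (by omega)⟩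
  | succ N ih =>
    intro V W h hr hN
    rcases W with _ | ⟨v, W⟩
    · have := eq_univ_of_closed hG hr fun a ha => h.closed a ha (by simp)
      rw [this, Finset.card_univ, Fintype.card_fin, List.length_nil] at hN
      omega
    · obtain ⟨ds, h1, h2⟩ := ih _ _ h.step (Finset.mem_union_left _ hr) (by
        rw [Finset.card_union_of_disjoint (disjoint_newNeighbors V v), List.length_append,
          Finset.length_sort]
        simp at hN
        omega)
      exact ⟨(newNeighbors G V v).card :: ds, by simp [h1], rfl, h2⟩

theorem reachable_of_searchDegrees {r : Fin (n + 1)} (ds : List ℕ) :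
    ∀ (V : Finset (Fin (n + 1))) (W : List (Fin (n + 1))), SearchDegrees G ds V W →
    (∀ a ∈ V, G.Reachable r a) → (∀ a ∈ W, a ∈ V) → V.card + ds.sum = n + 1 →
    ∀ a, G.Reachable r a := by
  induction ds with
  | nil =>
    intro V W _ hV _ hc a
    refine hV a ?_
    rw [(Finset.card_eq_iff_eq_univ V).1 (by simpa using hc)]
    exact Finset.mem_univ a
  | cons k ds ih =>
    intro V W h hV hW hc
    rcases W with _ | ⟨v, W⟩
    · exact h.elim
    refine ih _ _ h.2 (fun a ha => ?_) (fun a ha => ?_) ?_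
    · rcases Finset.mem_union.1 ha with ha | ha
      · exact hV a ha
      · exact (hV v (hW v (by simp))).trans (mem_newNeighbors.1 ha).1.reachable
    · rw [List.mem_append, Finset.mem_sort] at ha
      rw [Finset.mem_union]
      exact ha.elim Or.inr fun ha => Or.inl (hW a (List.mem_cons_of_mem _ ha))
    · rw [Finset.card_union_of_disjoint (disjoint_newNeighbors V v), h.1]
      simp at hc
      omega

theorem SearchDegrees.unique {ds : List ℕ} : ∀ {es : List ℕ} {V : Finset (Fin (n + 1))}
    {W : List (Fin (n + 1))}, SearchDegrees G ds V W → SearchDegrees G es V W → ds = es := by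
  induction ds with
  | nil =>
    intro es V W h h'
    rw [SearchDegrees] at h
    subst h
    cases es with
    | nil => rfl
    | cons => exact h'.elim
  | cons k ds ih =>
    intro es V W h h'
    rcases W with _ | ⟨v, W⟩
    · exact h.elim
    cases es with
    | nil => simp [SearchDegrees] at h'
    | cons l es => rw [ih h.2 h'.2, ← h.1, ← h'.1]

theorem SearchDegrees.congr {H : SimpleGraph (Fin (n + 1))} (ds : List ℕ) :
    ∀ (V : Finset (Fin (n + 1))) (W : List (Fin (n + 1))),
    (∀ a b, a ∈ W ∨ a ∉ V → b ∉ V → (G.Adj a b ↔ H.Adj a b)) →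
    (SearchDegrees G ds V W ↔ SearchDegrees H ds V W) := by
  induction ds with
  | nil => intros; rfl
  | cons k ds ih =>
    intro V W h
    rcases W with _ | ⟨v, W⟩
    · rfl
    have hn : newNeighbors G V v = newNeighbors H V v := by
      ext w
      rw [mem_newNeighbors, mem_newNeighbors]
      exact and_congr_left fun hw => h v w (by simp) hw
    rw [SearchDegrees, SearchDegrees, hn]
    refine and_congr_right fun _ => ih _ _ fun a b ha hb => h a b ?_ ?_
    · simp only [List.mem_append, Finset.mem_sort, Finset.mem_union, mem_newNeighbors] at ha
      simp only [List.mem_cons]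
      tauto
    · exact fun hb' => hb (Finset.mem_union_left _ hb')

theorem validState_init : ValidState G {Fin.last n} [Fin.last n] where
  nodup := by simp
  subset := by simp
  closed := by simp

theorem searchDegrees_degSeq_psi (hG : G.Connected) :
    SearchDegrees G (Psi G).degSeq {Fin.last n} [Fin.last n] ∧ (Psi G).numNodes = n + 1 := by
  obtain ⟨ds, h1, h2⟩ := exists_searchDegrees hG (r := Fin.last n) (n + 1) _ _ validState_init
    (by simp) (by simp)
  have h := (degSeqForest_eraseLabels ds (NFSState.init n) validState_init h2 n h1.le).1
  rw [h1] at h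
  have h3 : PlaneTree.degSeqForest [Psi G] = ds := h
  have h4 := PlaneTree.length_degSeqForest [Psi G]
  rw [h3, h1, PlaneTree.numNodesForest_singleton] at h4
  rw [PlaneTree.degSeqForest_singleton] at h3
  exact ⟨h3 ▸ h2, h4.symm⟩

theorem connected_and_psi_eq_iff {T : PlaneTree} (hT : T.numNodes = n + 1) :
    G.Connected ∧ Psi G = T ↔ SearchDegrees G T.degSeq {Fin.last n} [Fin.last n] := by
  constructor
  · rintro ⟨hG, rfl⟩
    exact (searchDegrees_degSeq_psi hG).1
  · intro h
    have hs := PlaneTree.sum_degSeqForest [T]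
    rw [PlaneTree.degSeqForest_singleton, PlaneTree.numNodesForest_singleton, hT] at hs
    have hr := reachable_of_searchDegrees (r := Fin.last n) _ _ _ h
      (fun a ha => by rw [Finset.mem_singleton.1 ha]) (by simp)
      (by simp at hs ⊢; omega)
    have hG : G.Connected := ⟨fun a b => (hr a).symm.trans (hr b)⟩
    exact ⟨hG, PlaneTree.degSeq_injective ((searchDegrees_degSeq_psi hG).1.unique h)⟩

end search

section counting

variable {n : ℕ}

open Classical in
/-- The graphs without edges at the nodes that have been active already, for which the search
that starts with visited nodes `V` and waiting nodes `W` has the degrees `ds`. -/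
noncomputable def searchGraphs (ds : List ℕ) (V : Finset (Fin (n + 1)))
    (W : List (Fin (n + 1))) : Finset (SimpleGraph (Fin (n + 1))) :=
  Finset.univ.filter fun G => (∀ a b, G.Adj a b → a ∈ W ∨ a ∉ V) ∧ SearchDegrees G ds V W

theorem mem_searchGraphs {ds : List ℕ} {V : Finset (Fin (n + 1))}
    {W : List (Fin (n + 1))} {G : SimpleGraph (Fin (n + 1))} :
    G ∈ searchGraphs ds V W ↔
      (∀ a b, G.Adj a b → a ∈ W ∨ a ∉ V) ∧ SearchDegrees G ds V W := by
  simp [searchGraphs]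

/-- The graph `G` without the edges at `v`. -/
def isolate (G : SimpleGraph (Fin (n + 1))) (v : Fin (n + 1)) : SimpleGraph (Fin (n + 1)) where
  Adj a b := G.Adj a b ∧ a ≠ v ∧ b ≠ v
  symm := ⟨fun _ _ h => ⟨h.1.symm, h.2.2, h.2.1⟩⟩
  loopless := ⟨fun _ h => h.1.ne rfl⟩

/-- The graph `G` with additional edges from `v` to the nodes in `S`. -/
def addStar (G : SimpleGraph (Fin (n + 1))) (v : Fin (n + 1)) (S : Finset (Fin (n + 1))) :
    SimpleGraph (Fin (n + 1)) :=
  G ⊔ SimpleGraph.fromRel fun a b => a = v ∧ b ∈ S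

theorem addStar_adj {G : SimpleGraph (Fin (n + 1))} {v : Fin (n + 1)}
    {S : Finset (Fin (n + 1))} {a b : Fin (n + 1)} : (addStar G v S).Adj a b ↔
      G.Adj a b ∨ a ≠ b ∧ (a = v ∧ b ∈ S ∨ b = v ∧ a ∈ S) := by
  simp [addStar]

open Classical in
theorem card_searchGraphs_fiber (k : ℕ) (ds : List ℕ) (V : Finset (Fin (n + 1)))
    (v : Fin (n + 1)) (W : List (Fin (n + 1))) (hW : (v :: W).Nodup) (hV : ∀ a ∈ v :: W, a ∈ V)
    (R C : Finset (Fin (n + 1))) (hR : ∀ a ∈ R, a ∈ W) (hC : ∀ a ∈ C, a ∉ V) (hk : C.card = k) :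
    ((searchGraphs (k :: ds) V (v :: W)).filter fun G =>
      (W.toFinset.filter fun a => G.Adj v a, newNeighbors G V v) = (R, C)).card =
      (searchGraphs ds (V ∪ C) (C.sort (· ≤ ·) ++ W)).card := by
  have hvV : v ∈ V := hV v (by simp)
  have hvW : v ∉ W := (List.nodup_cons.1 hW).1
  have hvC : v ∉ C := fun h => hC v h hvV
  have hvR : v ∉ R := fun h => hvW (hR v h)
  have hagree : ∀ {G H : SimpleGraph (Fin (n + 1))}, (∀ a b, a ≠ v → b ≠ v →
      (G.Adj a b ↔ H.Adj a b)) → (SearchDegrees G ds (V ∪ C) (C.sort (· ≤ ·) ++ W) ↔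
        SearchDegrees H ds (V ∪ C) (C.sort (· ≤ ·) ++ W)) := by
    intro G H h
    refine SearchDegrees.congr ds _ _ fun a b ha hb => h a b ?_ ?_
    · rintro rfl
      simp [hvC, hvW, hvV] at ha
    · rintro rfl
      simp [hvV] at hb
  refine Finset.card_bij' (fun G _ => isolate G v) (fun G _ => addStar G v (R ∪ C)) ?_ ?_ ?_ ?_
  · intro G hG
    rw [Finset.mem_filter, mem_searchGraphs, Prod.mk.injEq] at hG
    obtain ⟨⟨h1, h2⟩, -, h4⟩ := hG
    rw [SearchDegrees, h4] at h2
    rw [mem_searchGraphs]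
    refine ⟨fun a b hab => ?_, (hagree fun a b ha hb => ?_).1 h2.2⟩
    · have := h1 a b hab.1
      simp only [List.mem_cons, hab.2.1, false_or] at this
      simp only [List.mem_append, Finset.mem_sort, Finset.mem_union]
      tauto
    · simp [isolate, ha, hb]
  · intro G hG
    rw [mem_searchGraphs] at hG
    obtain ⟨h1, h2⟩ := hG
    have hv : ∀ b, ¬ G.Adj v b := fun b hb => by
      have := h1 v b hb
      simp [hvC, hvW, hvV] at this
    have hstar : ∀ b, (addStar G v (R ∪ C)).Adj v b ↔ b ∈ R ∨ b ∈ C := by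
      intro b
      rw [addStar_adj, Finset.mem_union]
      constructor
      · rintro (h | ⟨_, h | h⟩)
        · exact (hv b h).elim
        · exact h.2
        · simp [hvR, hvC] at h
      · intro h
        refine Or.inr ⟨?_, Or.inl ⟨rfl, h⟩⟩
        rintro rfl
        tauto
    have hnew : newNeighbors (addStar G v (R ∪ C)) V v = C := by
      ext b
      rw [mem_newNeighbors, hstar]
      constructor
      · rintro ⟨h | h, hb⟩
        · exact (hb (hV b (List.mem_cons_of_mem _ (hR b h)))).elim
        · exact h
      · exact fun h => ⟨Or.inr h, hC b h⟩
    rw [Finset.mem_filter, mem_searchGraphs, Prod.mk.injEq]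
    refine ⟨⟨fun a b hab => ?_, ?_⟩, ?_, hnew⟩
    · rw [addStar_adj] at hab
      rcases hab with h | ⟨_, h | h⟩
      · have := h1 a b h
        simp only [List.mem_append, Finset.mem_sort, Finset.mem_union] at this
        have := hC a
        simp only [List.mem_cons]
        tauto
      · simp [h.1]
      · rcases Finset.mem_union.1 h.2 with h | h
        · exact Or.inl (List.mem_cons_of_mem _ (hR a h))
        · exact Or.inr (hC a h)
    · rw [SearchDegrees, hnew]
      refine ⟨hk, (hagree fun a b ha hb => ?_).1 h2⟩
      simp [addStar_adj, ha, hb]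
    · ext b
      rw [Finset.mem_filter, hstar, List.mem_toFinset]
      constructor
      · rintro ⟨hb, h | h⟩
        · exact h
        · exact (hC b h (hV b (List.mem_cons_of_mem _ hb))).elim
      · exact fun h => ⟨hR b h, Or.inl h⟩
  · intro G hG
    rw [Finset.mem_filter, mem_searchGraphs, Prod.mk.injEq] at hG
    obtain ⟨⟨h1, -⟩, h3, h4⟩ := hG
    have hv : ∀ b, G.Adj v b ↔ b ∈ R ∪ C := by
      intro b
      rw [Finset.mem_union, ← h3, ← h4, Finset.mem_filter, mem_newNeighbors, List.mem_toFinset]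
      refine ⟨fun h => ?_, by tauto⟩
      have := h1 b v h.symm
      simp only [List.mem_cons, h.ne', false_or] at this
      tauto
    ext a b
    rw [addStar_adj]
    by_cases ha : a = v
    · subst ha
      rw [← hv, ← hv]
      have := G.ne_of_adj (a := a) (b := b)
      simp [isolate]
      tauto
    · by_cases hb : b = v
      · subst hb
        rw [← hv, ← hv, G.adj_comm b a]
        simp [isolate, ha]
      · simp [isolate, ha, hb]
  · intro G hG
    rw [mem_searchGraphs] at hG
    have hv : ∀ b, ¬ G.Adj v b := fun b hb => by
      have := hG.1 v b hb
      simp [hvC, hvW, hvV] at this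
    ext a b
    simp only [isolate, addStar_adj]
    by_cases ha : a = v
    · subst ha; simp [hv]
    · by_cases hb : b = v
      · subst hb; simp [G.adj_comm a b, hv]
      · simp [ha, hb]

open PlaneTree in
theorem card_searchGraphs (ts : List PlaneTree) : ∀ (V : Finset (Fin (n + 1)))
    (W : List (Fin (n + 1))), W.Nodup → (∀ a ∈ W, a ∈ V) → ts.length = W.length →
    numNodesForest ts = W.length + Vᶜ.card →
    (searchGraphs (degSeqForest ts) V W).card * ((degSeqForest ts).map Nat.factorial).prod *
      2 ^ weightedSum (degSeqForest ts) = 2 ^ (numNodesForest ts).choose 2 * (Vᶜ.card)! := by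
  classical
  induction ts using forest_induction with
  | nil =>
    intro V W _ _ hlen hcard
    have hW : W = [] := List.length_eq_zero_iff.1 (by simpa using hlen.symm)
    subst hW
    have hV0 : Vᶜ.card = 0 := by simpa [numNodesForest] using hcard.symm
    have hV : V = Finset.univ := by simpa using hV0
    have : searchGraphs (degSeqForest []) V [] = {⊥} := by
      ext G
      rw [mem_searchGraphs, Finset.mem_singleton, hV]
      simp only [degSeqForest, SearchDegrees, List.not_mem_nil, Finset.mem_univ, not_true,
        or_self, imp_false, and_true]
      constructor
      · intro h; ext a b; simp [h]
      · rintro rfl; simp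
    rw [this, hV0]
    simp [degSeqForest, numNodesForest, weightedSum]
  | node_cons ts rest ih =>
    intro V W hnd hV hlen hcard
    rcases W with _ | ⟨v, W⟩
    · simp at hlen
    rw [degSeqForest_node_cons, numNodesForest_node_cons] at *
    have hs := sum_degSeqForest (ts ++ rest)
    have hle := length_le_numNodesForest (ts ++ rest)
    simp only [List.length_cons, List.length_append, add_left_inj] at *
    set N := numNodesForest (ts ++ rest)
    set k := ts.length
    set ds := degSeqForest (ts ++ rest)
    set m := Vᶜ.card with hm
    have hfib := Finset.card_eq_sum_card_fiberwise
      (f := fun G : SimpleGraph (Fin (n + 1)) =>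
        (W.toFinset.filter fun a => G.Adj v a, newNeighbors G V v))
      (s := searchGraphs (k :: ds) V (v :: W))
      (t := W.toFinset.powerset ×ˢ Vᶜ.powersetCard k) (by
        intro G hG
        rw [Finset.mem_coe, mem_searchGraphs] at hG
        rw [Finset.mem_coe, Finset.mem_product, Finset.mem_powerset, Finset.mem_powersetCard]
        refine ⟨Finset.filter_subset _ _, fun a ha => ?_, hG.2.1⟩
        rw [Finset.mem_compl]
        exact (mem_newNeighbors.1 ha).2)
    have hterm : ∀ p ∈ W.toFinset.powerset ×ˢ Vᶜ.powersetCard k,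
        ((searchGraphs (k :: ds) V (v :: W)).filter fun G =>
          (W.toFinset.filter fun a => G.Adj v a, newNeighbors G V v) = p).card *
          ((ds.map Nat.factorial).prod * 2 ^ weightedSum ds) = 2 ^ N.choose 2 * (m - k)! := by
      rintro ⟨R, C⟩ hp
      rw [Finset.mem_product, Finset.mem_powerset, Finset.mem_powersetCard] at hp
      obtain ⟨hR, hC, hCk⟩ := hp
      have hC' : ∀ a ∈ C, a ∉ V := fun a ha => Finset.mem_compl.1 (hC ha)
      rw [card_searchGraphs_fiber k ds V v W hnd hV R C (fun a ha => List.mem_toFinset.1 (hR ha))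
        hC' hCk]
      have hcompl : (V ∪ C)ᶜ.card = m - k := by
        rw [Finset.compl_union, ← hCk, hm, ← Finset.sdiff_eq_inter_compl,
          Finset.card_sdiff_of_subset hC]
      have := ih (V ∪ C) (C.sort (· ≤ ·) ++ W) ?_ ?_ ?_ ?_
      · rw [← mul_assoc, this, hcompl]
      · refine List.Nodup.append (Finset.sort_nodup _ _) (List.nodup_cons.1 hnd).2 ?_
        intro a ha haW
        rw [Finset.mem_sort] at ha
        exact hC' a ha (hV a (List.mem_cons_of_mem _ haW))
      · intro a ha
        rw [List.mem_append, Finset.mem_sort] at ha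
        rw [Finset.mem_union]
        exact ha.elim Or.inr fun ha => Or.inl (hV a (List.mem_cons_of_mem _ ha))
      · rw [List.length_append, Finset.length_sort, hCk, hlen]
      · rw [List.length_append, Finset.length_sort, hCk, hcompl]
        omega
    have hWcard : W.toFinset.card = W.length :=
      List.toFinset_card_of_nodup (List.nodup_cons.1 hnd).2
    have htot : (searchGraphs (k :: ds) V (v :: W)).card *
        ((ds.map Nat.factorial).prod * 2 ^ weightedSum ds) =
        2 ^ W.length * m.choose k * (2 ^ N.choose 2 * (m - k)!) := by
      rw [hfib, Finset.sum_mul, Finset.sum_congr rfl hterm, Finset.sum_const, Finset.card_product,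
        Finset.card_powerset, Finset.card_powersetCard, hWcard, smul_eq_mul]
    have hkm : k ≤ m := by omega
    have hchoose : (1 + N).choose 2 = W.length + (k + ds.sum) + N.choose 2 := by
      rw [add_comm 1 N, Nat.choose_succ_succ' N 1, Nat.choose_one_right]
      simp only [Nat.reduceAdd]
      omega
    rw [List.map_cons, List.prod_cons, weightedSum, hchoose,
      ← Nat.choose_mul_factorial_mul_factorial hkm]
    rw [show k + (weightedSum ds + ds.sum) = weightedSum ds + (k + ds.sum) by ring,
      pow_add 2 (weightedSum ds), pow_add 2 (W.length + _), pow_add 2 W.length]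
    calc _ = (searchGraphs (k :: ds) V (v :: W)).card *
        ((ds.map Nat.factorial).prod * 2 ^ weightedSum ds) * (k ! * 2 ^ (k + ds.sum)) := by ring
      _ = _ := by rw [htot]; ring

end counting

open PlaneTree in
theorem ncard_psi_eq (n : ℕ) (T : PlaneTree) (hT : T.numNodes = n + 1) :
    {G : SimpleGraph (Fin (n + 1)) | G.Connected ∧ Psi G = T}.ncard *
      (T.degSeq.map Nat.factorial).prod * 2 ^ weightedSum T.degSeq =
      2 ^ (n + 1).choose 2 * n ! := by
  have hset : {G : SimpleGraph (Fin (n + 1)) | G.Connected ∧ Psi G = T} =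
      (searchGraphs T.degSeq {Fin.last n} [Fin.last n] : Set _) := by
    ext G
    rw [Set.mem_ofPred_eq, connected_and_psi_eq_iff hT, Finset.mem_coe, mem_searchGraphs]
    simp [em]
  have h := card_searchGraphs [T] {Fin.last n} [Fin.last n] (by simp) (by simp) rfl (by
    rw [numNodesForest_singleton, hT, Finset.card_compl]; simp [add_comm])
  rw [degSeqForest_singleton, numNodesForest_singleton, hT, Finset.card_compl] at h
  rw [hset, Set.ncard_coe_finset, h]
  simp

@[to_additive]
theorem prod_Icc_getD {M : Type*} [CommMonoid M] (f : ℕ → M) (l : List ℕ) :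
    ∏ i ∈ Finset.Icc 1 l.length, f (l.getD (i - 1) 0) = (l.map f).prod := by
  induction l using List.reverseRecOn with
  | nil => simp
  | append_singleton l a ih =>
    rw [List.length_append, List.length_singleton, Finset.prod_Icc_succ_top (by omega),
      List.map_append, List.prod_append, ← ih]
    congr 1
    · refine Finset.prod_congr rfl fun i hi => ?_
      rw [Finset.mem_Icc] at hi
      rw [List.getD_append _ _ _ _ (by omega)]
    · simp

namespace PlaneTree

theorem weightedSum_append (l m : List ℕ) :
    weightedSum (l ++ m) = weightedSum l + (weightedSum m + l.length * m.sum) := by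
  induction l with
  | nil => simp [weightedSum]
  | cons k l ih => simp [weightedSum, ih]; ring

theorem sum_Icc_mul_getD (l : List ℕ) :
    ∑ i ∈ Finset.Icc 1 l.length, i * l.getD (i - 1) 0 = weightedSum l := by
  induction l using List.reverseRecOn with
  | nil => simp [weightedSum]
  | append_singleton l a ih =>
    rw [List.length_append, List.length_singleton, Finset.sum_Icc_succ_top (by omega),
      weightedSum_append, ← ih]
    congr 1
    · refine Finset.sum_congr rfl fun i hi => ?_
      rw [Finset.mem_Icc] at hi
      rw [List.getD_append _ _ _ _ (by omega)]
    · simp [weightedSum]; ring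

theorem length_degSeq (T : PlaneTree) : T.degSeq.length = T.numNodes := by
  have := length_degSeqForest [T]
  rwa [degSeqForest_singleton, numNodesForest_singleton] at this

theorem sum_mul_deg (T : PlaneTree) :
    ∑ i ∈ Finset.Icc 1 T.numNodes, i * T.deg i = weightedSum T.degSeq := by
  rw [← length_degSeq]
  exact sum_Icc_mul_getD _

theorem sum_deg (T : PlaneTree) : ∑ i ∈ Finset.Icc 1 T.numNodes, T.deg i + 1 = T.numNodes := by
  have hs := sum_degSeqForest [T]
  rw [degSeqForest_singleton, numNodesForest_singleton] at hs
  have := sum_Icc_getD id T.degSeq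
  rw [length_degSeq, List.map_id] at this
  rw [List.length_singleton, ← this] at hs
  exact hs

theorem prod_factorial_deg (T : PlaneTree) :
    ∏ i ∈ Finset.Icc 1 T.numNodes, (T.deg i)! = (T.degSeq.map Nat.factorial).prod := by
  rw [← length_degSeq]
  exact prod_Icc_getD _ _

theorem prod_factorial_pos (l : List ℕ) : 0 < (l.map Nat.factorial).prod :=
  List.prod_pos (by simp [Nat.factorial_pos])

end PlaneTree

theorem ncard_psi_eq_multinomial (n : ℕ) (T : PlaneTree) (hT : T.numNodes = n + 1) :
    (({G : SimpleGraph (Fin (n + 1)) | G.Connected ∧ Psi G = T}.ncard : ℕ) : ℝ) =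
      (2 : ℝ) ^ (((n + 1).choose 2 : ℤ) - ∑ i ∈ Finset.Icc 1 (n + 1), (i : ℤ) * (T.deg i : ℤ)) *
        (Nat.multinomial (Finset.Icc 1 (n + 1)) T.deg : ℝ) := by
  have h := ncard_psi_eq n T hT
  have hw := T.sum_mul_deg
  have hm := Nat.multinomial_spec (Finset.Icc 1 (n + 1)) T.deg
  have hsum := T.sum_deg
  have hp := T.prod_factorial_deg
  rw [hT] at hw hsum hp
  rw [show ∑ i ∈ Finset.Icc 1 (n + 1), T.deg i = n by omega, hp] at hm
  have hpos := PlaneTree.prod_factorial_pos T.degSeq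
  rw [← hm] at h
  have h' : {G : SimpleGraph (Fin (n + 1)) | G.Connected ∧ Psi G = T}.ncard *
      2 ^ PlaneTree.weightedSum T.degSeq =
      2 ^ (n + 1).choose 2 * Nat.multinomial (Finset.Icc 1 (n + 1)) T.deg := by
    refine Nat.eq_of_mul_eq_mul_left hpos ?_
    linarith
  have hcast : ∑ i ∈ Finset.Icc 1 (n + 1), (i : ℤ) * (T.deg i : ℤ) =
      (PlaneTree.weightedSum T.degSeq : ℤ) := by
    rw [← hw]; push_cast; rfl
  rw [hcast, zpow_sub₀ two_ne_zero, zpow_natCast, zpow_natCast, div_mul_eq_mul_div,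
    eq_div_iff (by positivity)]
  exact_mod_cast h'

open MeasureTheory in
theorem factorial_mul_volume_treePolytope (n : ℕ) (T : PlaneTree) (hT : T.numNodes = n + 1) :
    (n ! : ℝ≥0∞) * volume (treePolytope n T) =
      (({G : SimpleGraph (Fin (n + 1)) | G.Connected ∧ Psi G = T}.ncard : ℕ) : ℝ≥0∞) := by
  have h1 := ncard_psi_eq n T hT
  have h2 := cellVolume_mul_eq n T hT
  have hpos : (0 : ℝ) < ((T.degSeq.map Nat.factorial).prod : ℕ) := by
    exact_mod_cast PlaneTree.prod_factorial_pos T.degSeq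
  have key : (n ! : ℝ) * cellVolume (PlaneTree.exponents T.degSeq 1) =
      ({G : SimpleGraph (Fin (n + 1)) | G.Connected ∧ Psi G = T}.ncard : ℕ) := by
    have h1' : (({G : SimpleGraph (Fin (n + 1)) | G.Connected ∧ Psi G = T}.ncard : ℕ) : ℝ) *
      ((T.degSeq.map Nat.factorial).prod : ℕ) * 2 ^ PlaneTree.weightedSum T.degSeq =
      2 ^ (n + 1).choose 2 * (n ! : ℕ) := by exact_mod_cast h1
    rw [← h2] at h1'
    have hw : (0 : ℝ) < 2 ^ PlaneTree.weightedSum T.degSeq := by positivity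
    refine mul_right_cancel₀ (mul_pos hpos hw).ne' ?_
    linarith
  rw [volume_treePolytope n T hT, ← ENNReal.ofReal_natCast, ← ENNReal.ofReal_mul (by positivity),
    key, ENNReal.ofReal_natCast]

open MeasureTheory in
theorem volume_treePolytope_inter (n : ℕ) (S T : PlaneTree) (hS : S.numNodes = n + 1)
    (hT : T.numNodes = n + 1) (hne : S ≠ T) :
    volume (treePolytope n S ∩ treePolytope n T) = 0 := by
  rw [treePolytope_eq_dyadicCell n S hS, treePolytope_eq_dyadicCell n T hT]
  have h1 := PlaneTree.length_exponents_degSeq S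
  have h2 := PlaneTree.length_exponents_degSeq T
  exact volume_dyadicCell_inter 1 (by omega) (by omega)
    fun h => hne (PlaneTree.exponents_injective h)

theorem isPolytopalSubdivision_treePolytope (n : ℕ) :
    IsPolytopalSubdivision (cayleyPolytope n)
      (fun T : {T : PlaneTree // T.numNodes = n + 1} => treePolytope n T.1) where
  finite := inferInstance
  isPolytope T := by
    rw [treePolytope_eq_dyadicCell n T.1 T.2]
    exact isPolytope_dyadicCell _ _ _
  interior_nonempty T := by
    refine interior_nonempty_of_volume_ne_zero ?_ ?_
    · rw [treePolytope_eq_dyadicCell n T.1 T.2]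
      exact convex_dyadicCell _ _ _
    · rw [volume_treePolytope n T.1 T.2, Ne, ENNReal.ofReal_eq_zero, not_le]
      exact cellVolume_pos _
  iUnion_eq := iUnion_treePolytope n
  interior_disjoint S T hne := disjoint_interior_of_volume_inter
    (volume_treePolytope_inter n S.1 T.1 S.2 T.2 fun h => hne (Subtype.ext h))
  inter_face S T := by
    rw [treePolytope_eq_dyadicCell n S.1 S.2, treePolytope_eq_dyadicCell n T.1 T.2]
    refine ⟨isExposed_dyadicCell_inter _ _ _ _, ?_⟩
    rw [Set.inter_comm]
    exact isExposed_dyadicCell_inter _ _ _ _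

theorem ncard_connected_eq_sum (n : ℕ) [Fintype {T : PlaneTree // T.numNodes = n + 1}] :
    {G : SimpleGraph (Fin (n + 1)) | G.Connected}.ncard =
      ∑ T : {T : PlaneTree // T.numNodes = n + 1},
        {G : SimpleGraph (Fin (n + 1)) | G.Connected ∧ Psi G = T.1}.ncard := by
  rw [← finsum_eq_sum_of_fintype, ← Set.ncard_iUnion_of_finite (fun _ => Set.toFinite _)]
  · congr 1
    ext G
    simp only [Set.mem_iUnion, Set.mem_ofPred_eq]
    exact ⟨fun h => ⟨⟨Psi G, (searchDegrees_degSeq_psi h).2⟩, h, rfl⟩, fun ⟨_, h, _⟩ => h⟩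
  · intro S T hne
    refine Set.disjoint_left.2 fun G h h' => hne (Subtype.ext ?_)
    exact h.2.symm.trans h'.2

open MeasureTheory in
theorem factorial_mul_volume_cayleyPolytope (n : ℕ) :
    (n ! : ℝ≥0∞) * volume (cayleyPolytope n) =
      (({G : SimpleGraph (Fin (n + 1)) | G.Connected}.ncard : ℕ) : ℝ≥0∞) := by
  have := Fintype.ofFinite {T : PlaneTree // T.numNodes = n + 1}
  rw [← iUnion_treePolytope, measure_iUnion₀, ← ENNReal.tsum_mul_left, tsum_fintype,
    ncard_connected_eq_sum, Nat.cast_sum]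
  · exact Finset.sum_congr rfl fun T _ => factorial_mul_volume_treePolytope n T.1 T.2
  · exact fun S T hne => volume_treePolytope_inter n S.1 T.1 S.2 T.2 fun h => hne (Subtype.ext h)
  · intro T
    rw [treePolytope_eq_dyadicCell n T.1 T.2]
    exact (isClosed_dyadicCell _ _ _).measurableSet.nullMeasurableSet

theorem theorem4p1 (n : ℕ) :
    (∀ T : PlaneTree, T.numNodes = n + 1 →
      IsPolytope (treePolytope n T) ∧
      Bornology.IsBounded (treePolytope n T) ∧
      (n ! : ℝ≥0∞) * MeasureTheory.volume (treePolytope n T) =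
        (({G : SimpleGraph (Fin (n + 1)) | G.Connected ∧ Psi G = T}.ncard : ℕ) : ℝ≥0∞) ∧
      (({G : SimpleGraph (Fin (n + 1)) | G.Connected ∧ Psi G = T}.ncard : ℕ) : ℝ) =
        (2 : ℝ) ^ (((n + 1).choose 2 : ℤ) - ∑ i ∈ Finset.Icc 1 (n + 1), (i : ℤ) * (T.deg i : ℤ)) *
          (Nat.multinomial (Finset.Icc 1 (n + 1)) T.deg : ℝ)) ∧
    Nat.card {T : PlaneTree // T.numNodes = n + 1} = catalan n ∧
    IsPolytopalSubdivision (cayleyPolytope n)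
      (fun T : {T : PlaneTree // T.numNodes = n + 1} => treePolytope n T.1) ∧
    (n ! : ℝ≥0∞) * MeasureTheory.volume (cayleyPolytope n) =
      (({G : SimpleGraph (Fin (n + 1)) | G.Connected}.ncard : ℕ) : ℝ≥0∞) := by
  refine ⟨fun T hT => ⟨?_, ?_, factorial_mul_volume_treePolytope n T hT,
    ncard_psi_eq_multinomial n T hT⟩, PlaneTree.card_numNodes n,
    isPolytopalSubdivision_treePolytope n, factorial_mul_volume_cayleyPolytope n⟩
  · rw [treePolytope_eq_dyadicCell n T hT]
    exact isPolytope_dyadicCell _ _ _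
  · rw [treePolytope_eq_dyadicCell n T hT]
    exact isBounded_dyadicCell _ _ _
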